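/- Let $d,\alpha\ge 1$ be integers, $\mathbb N=\{1,2,\dots\}$, $\rho(x)=(2\pi)^{-d/2}e^{-|x|^2/2}$ on $\mathbb R^d$, and let $H^\alpha_\rho=H^\alpha_\rho(\mathbb R^d)$ be the space of functions whose weak derivatives $D^{\mathbf r}f$ with $|\mathbf r|_\infty\le\alpha$ exist and lie in $L^2_\rho$, with the norm $\|f\|_{H^\alpha_\rho}=\bigl(\sum_{|\mathbf r|_\infty\le\alpha}\|D^{\mathbf r}f\|_{L^2_\rho}^2\bigr)^{1/2}$. Elements of $H^\alpha_\rho$ are identified with their continuous representatives. Let $n_1,n_2,\dots$ be non-negative integers. For $\ell\ge1$ let $\mathscr I^{\mathrm{uni}}_\ell$ be polynomial interpolation at the zeros of the Hermite polynomial $H_{n_\ell+1}$ (orthogonal with respect to the univariate Gaussian density), and let $\mathscr I^{\mathrm{uni}}_0=0$. For a finite set $\Lambda\subset\mathbb N^d$ put $$\mathscr I_\Lambda=\sum_{\boldsymbol\ell\in\Lambda}(\mathscr I^{\mathrm{uni}}_{\ell_1}-\mathscr I^{\mathrm{uni}}_{\ell_1-1})\otimes\cdots\otimes(\mathscr I^{\mathrm{uni}}_{\ell_d}-\mathscr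 I^{\mathrm{uni}}_{\ell_d-1}).$$ We say that $\mathscr I_\Lambda$ uses $N\ge1$ point evaluations if there are points $x_1,\dots,x_N\in\mathbb R^d$ such that $\mathscr I_\Lambda(f)$, for $f\in H^\alpha_\rho$, depends on $f$ only through $f(x_1),\dots,f(x_N)$; for instance, this holds with $N$ the number of distinct nodes of the sparse grid. The set $\Lambda$ is called downward-closed in one direction if there is $j\in\{1,\dots,d\}$ such that $(1,\dots,1,\ell,1,\dots,1)\in\Lambda$ (with $\ell$ in position $j$) implies $(1,\dots,1,k,1,\dots,1)\in\Lambda$ for all integers $1\le k\le\ell$. **Theorem.** (i) There is a constant $c>0$ depending only on $\alpha$ and $d$ such that, for all $(n_\ell)_{\ell\ge1}$, every finite $\Lambda\subset\mathbb N^d$ that is downward-closed in one direction, and every $N\ge1$ such that $\mathscr I_\Lambda$ uses $N$ point evaluations, $$\sup_{0\ne f\in H^\alpha_\rho}\frac{\|f-\mathscr I_\Lambda(f)\|_{L^1_\rho}}{\|f\|_{H^\alpha_\rho}}\ \ge\ c\,N^{-\alpha/2}.$$ (ii) Let $M_0>0$ and $M>1$. There is a constant $c>0$ depending only on $\alpha,d,M_0,M$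 such that the following holds. Let $L\ge d$ and $\Lambda_L=\{\boldsymbol\ell\in\mathbb N^d:\ell_1+\dots+\ell_d\le L\}$, and suppose that $M^{\ell-1}\le n_\ell\le M_0(M^\ell-1)$ for all $\ell\ge1$ and $n_{L-d+1}\ge e^{d-1}$. Then, for every $N\ge1$ such that $\mathscr I_{\Lambda_L}$ uses $N$ point evaluations, $$\sup_{0\ne f\in H^\alpha_\rho}\frac{\|f-\mathscr I_{\Lambda_L}(f)\|_{L^1_\rho}}{\|f\|_{H^\alpha_\rho}}\ \ge\ c\,N^{-\alpha/2}(\ln N)^{\alpha(d-1)/2}.$$ -/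

import Mathlib

open MeasureTheory
open scoped ENNReal ContDiff

noncomputable section

namespace SparseGH

/-! ### The Gaussian Sobolev space of dominating mixed smoothness -/

/-- The standard Gaussian density `ρ(x) = exp(-|x|²/2) / (2π)^(d/2)`, `|x|` the Euclidean norm. -/
def rho {d : ℕ} (x : Fin d → ℝ) : ℝ :=
  Real.exp (-(∑ j, x j ^ 2) / 2) / (2 * Real.pi) ^ ((d : ℝ) / 2)

/-- The measure `ρ(x) dx` on `ℝ^d`. -/
def gauss (d : ℕ) : Measure (Fin d → ℝ) :=
  (volume : Measure (Fin d → ℝ)).withDensity (fun x => ENNReal.ofReal (rho x))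

/-- The `j`-th partial derivative. -/
def partialDeriv {d : ℕ} (j : Fin d) (φ : (Fin d → ℝ) → ℝ) : (Fin d → ℝ) → ℝ :=
  fun x => fderiv ℝ φ x (Pi.single j 1)

/-- The classical derivative `D^r φ = ∂₁^{r₁} ⋯ ∂_d^{r_d} φ`; it is applied to smooth `φ` only. -/
def multiDeriv {d : ℕ} (r : Fin d → ℕ) (φ : (Fin d → ℝ) → ℝ) : (Fin d → ℝ) → ℝ :=
  (List.finRange d).foldr (fun j ψ => (partialDeriv j)^[r j] ψ) φ

/-- `g` is the weak derivative `D^r f` on `ℝ^d`. -/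
def IsWeakDeriv {d : ℕ} (r : Fin d → ℕ) (f g : (Fin d → ℝ) → ℝ) : Prop :=
  LocallyIntegrable f ∧ LocallyIntegrable g ∧
    ∀ φ : (Fin d → ℝ) → ℝ, ContDiff ℝ ∞ φ → HasCompactSupport φ →
      ∫ x, f x * multiDeriv r φ x = (-1) ^ (∑ j, r j) * ∫ x, g x * φ x

/-- `‖D^r f‖_{L²_ρ}`. The weak derivative is unique up to null sets, so that the infimum runs over
a single class (see `weakDerivNorm_eq`); its value is `∞` if `f` has no weak derivative `D^r f`. -/
def weakDerivNorm {d : ℕ} (r : Fin d → ℕ) (f : (Fin d → ℝ) → ℝ) : ℝ≥0∞ :=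
  ⨅ (g : (Fin d → ℝ) → ℝ) (_ : IsWeakDeriv r f g), eLpNorm g 2 (gauss d)

lemma weakDerivNorm_eq {d : ℕ} {r : Fin d → ℕ} {f g : (Fin d → ℝ) → ℝ} (h : IsWeakDeriv r f g) :
    weakDerivNorm r f = eLpNorm g 2 (gauss d) := by
  refine le_antisymm (iInf₂_le g h) (le_iInf₂ fun g' h' => le_of_eq ?_)
  refine eLpNorm_congr_ae ((withDensity_absolutelyContinuous _ _).ae_le ?_)
  refine ae_eq_of_integral_contDiff_smul_eq h.2.1 h'.2.1 fun φ hφ hc => ?_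
  have h1 := (h.2.2 φ hφ hc).symm.trans (h'.2.2 φ hφ hc)
  have h2 := mul_left_cancel₀ (pow_ne_zero _ (by norm_num)) h1
  simpa [mul_comm] using h2

/-- `‖f‖_{H^α_ρ} = (∑_{|r|_∞ ≤ α} ‖D^r f‖²_{L²_ρ})^{1/2}`, as an extended real. -/
def sobolevNorm {d : ℕ} (α : ℕ) (f : (Fin d → ℝ) → ℝ) : ℝ≥0∞ :=
  (∑ r : Fin d → Fin (α + 1), weakDerivNorm (fun j => (r j : ℕ)) f ^ 2) ^ (1 / 2 : ℝ)

/-- The space `H^α_ρ(ℝ^d)`. For `α ≥ 1` every class in it has exactly one continuous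
representative, and point evaluation refers to that one. -/
def sobolevSpace (d α : ℕ) : Set ((Fin d → ℝ) → ℝ) :=
  {f | Continuous f ∧ sobolevNorm α f < ⊤}

/-! ### Tensor products of univariate operators -/

/-- Apply the univariate operator `T` to the `j`-th variable. -/
def actOn {d : ℕ} (T : (ℝ → ℝ) →ₗ[ℝ] (ℝ → ℝ)) (j : Fin d) (f : (Fin d → ℝ) → ℝ) :
    (Fin d → ℝ) → ℝ :=
  fun x => T (fun t => f (Function.update x j t)) (x j)

/-- `T₁ ⊗ ⋯ ⊗ T_d`: apply `T_j` to the `j`-th variable, for every `j`. -/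
def tensorOp {d : ℕ} (T : Fin d → (ℝ → ℝ) →ₗ[ℝ] (ℝ → ℝ)) (f : (Fin d → ℝ) → ℝ) :
    (Fin d → ℝ) → ℝ :=
  (List.finRange d).foldr (fun j g => actOn (T j) j g) f

/-- The defining property of the tensor product operator. -/
lemma tensorOp_prod {d : ℕ} (T : Fin d → (ℝ → ℝ) →ₗ[ℝ] (ℝ → ℝ)) (g : Fin d → ℝ → ℝ) :
    tensorOp T (fun x => ∏ j, g j (x j)) = fun x => ∏ j, T j (g j) (x j) := by
  have key : ∀ l : List (Fin d), l.Nodup →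
      l.foldr (fun j g => actOn (T j) j g) (fun x => ∏ j, g j (x j)) =
        fun x => ∏ j, (if j ∈ l then T j (g j) else g j) (x j) := by
    intro l
    induction l with
    | nil => intro _; simp
    | cons a l ih =>
      intro hl
      rw [List.nodup_cons] at hl
      rw [List.foldr_cons, ih hl.2]
      funext x
      have h1 : (fun t => ∏ j, (if j ∈ l then T j (g j) else g j) (Function.update x a t j)) =
          (∏ j ∈ Finset.univ.erase a, (if j ∈ l then T j (g j) else g j) (x j)) • g a := by
        funext t
        rw [← Finset.mul_prod_erase _ _ (Finset.mem_univ a)]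
        simp only [Function.update_self, hl.1, if_false, Pi.smul_apply, smul_eq_mul]
        rw [mul_comm]
        congr 1
        refine Finset.prod_congr rfl fun j hj => ?_
        rw [Function.update_of_ne (Finset.ne_of_mem_erase hj)]
      rw [actOn, h1, map_smul, ← Finset.mul_prod_erase _ _ (Finset.mem_univ a)]
      simp only [List.mem_cons_self, if_true, Pi.smul_apply, smul_eq_mul]
      rw [mul_comm]
      congr 1
      refine Finset.prod_congr rfl fun j hj => ?_
      simp [List.mem_cons, Finset.ne_of_mem_erase hj]
  rw [tensorOp, key _ (List.nodup_finRange d)]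
  simp

/-! ### Sparse-grid Gauss–Hermite interpolation -/

/-- The zeros of the probabilists' Hermite polynomial of degree `m`. -/
def hermiteZeros (m : ℕ) : Finset ℝ :=
  ((Polynomial.hermite m).map (Int.castRingHom ℝ)).roots.toFinset

/-- Polynomial interpolation at the points of `s`. -/
def polyInterp (s : Finset ℝ) : (ℝ → ℝ) →ₗ[ℝ] (ℝ → ℝ) where
  toFun g := fun t => (Lagrange.interpolate s id g).eval t
  map_add' g h := by funext t; rw [map_add, Polynomial.eval_add, Pi.add_apply]
  map_smul' a g := by funext t; rw [map_smul, Polynomial.eval_smul]; rfl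

/-- The univariate operator of level `ℓ`: zero for `ℓ = 0`, and otherwise interpolation at the zeros
of the Hermite polynomial of degree `n ℓ + 1`. -/
def uniInterp (n : ℕ → ℕ) (ℓ : ℕ) : (ℝ → ℝ) →ₗ[ℝ] (ℝ → ℝ) :=
  if ℓ = 0 then 0 else polyInterp (hermiteZeros (n ℓ + 1))

/-- The sparse-grid operator `∑_{ℓ ∈ Λ} ⨂_j (𝓘_{ℓ_j} - 𝓘_{ℓ_j - 1})`. -/
def sparseInterp {d : ℕ} (n : ℕ → ℕ) (Λ : Finset (Fin d → ℕ)) (f : (Fin d → ℝ) → ℝ) :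
    (Fin d → ℝ) → ℝ :=
  ∑ ℓ ∈ Λ, tensorOp (fun j => uniInterp n (ℓ j) - uniInterp n (ℓ j - 1)) f

/-- There is a direction `j` such that `(1,…,1,ℓ,1,…,1) ∈ Λ` (with `ℓ` at position `j`) implies
`(1,…,1,k,1,…,1) ∈ Λ` for all integers `1 ≤ k ≤ ℓ`. -/
def DownwardClosedInOneDirection {d : ℕ} (Λ : Finset (Fin d → ℕ)) : Prop :=
  ∃ j : Fin d, ∀ ℓ k : ℕ, 1 ≤ k → k ≤ ℓ →
    Function.update (fun _ => 1) j ℓ ∈ Λ → Function.update (fun _ => 1) j k ∈ Λ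

/-- The isotropic index set `{ℓ ∈ ℕ^d : ℓ_j ≥ 1 for all j, ℓ₁ + ⋯ + ℓ_d ≤ L}`. -/
def isotropicSet (d L : ℕ) : Finset (Fin d → ℕ) :=
  (Fintype.piFinset fun _ => Finset.Icc 1 L).filter fun ℓ => ∑ j, ℓ j ≤ L

/-- `A` uses (at most) `N` point evaluations: there are points `x₁, …, x_N` such that `A f`
depends on `f ∈ H^α_ρ` only through `f(x₁), …, f(x_N)`. -/
def UsesPointEvaluations {d : ℕ} (α N : ℕ) (A : ((Fin d → ℝ) → ℝ) → (Fin d → ℝ) → ℝ) : Prop :=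
  ∃ (x : Fin N → Fin d → ℝ) (Φ : (Fin N → ℝ) → (Fin d → ℝ) → ℝ),
    ∀ f ∈ sobolevSpace d α, A f = Φ (fun i => f (x i))

/-- The nodes of the univariate operator of level `ℓ`. -/
def uniNodes (n : ℕ → ℕ) (ℓ : ℕ) : Finset ℝ :=
  if ℓ = 0 then ∅ else hermiteZeros (n ℓ + 1)

/-- The set of all nodes that enter into the sparse-grid operator. -/
def sparseGrid {d : ℕ} (n : ℕ → ℕ) (Λ : Finset (Fin d → ℕ)) : Finset (Fin d → ℝ) :=
  Λ.biUnion fun ℓ => Fintype.piFinset fun j => uniNodes n (ℓ j) ∪ uniNodes n (ℓ j - 1)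

lemma uniInterp_congr (n : ℕ → ℕ) (ℓ : ℕ) {u v : ℝ → ℝ} (h : ∀ t ∈ uniNodes n ℓ, u t = v t) :
    uniInterp n ℓ u = uniInterp n ℓ v := by
  unfold uniInterp uniNodes at *
  split_ifs at * with h0
  · rfl
  · funext t
    simp only [polyInterp, LinearMap.coe_mk, AddHom.coe_mk]
    rw [Lagrange.interpolate_eq_of_values_eq_on _ _ h]

lemma tensorOp_congr {d : ℕ} (T : Fin d → (ℝ → ℝ) →ₗ[ℝ] (ℝ → ℝ)) (F : Fin d → Finset ℝ)
    (hT : ∀ j u v, (∀ t ∈ F j, u t = v t) → T j u = T j v) {f g : (Fin d → ℝ) → ℝ}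
    (h : ∀ x ∈ Fintype.piFinset F, f x = g x) : tensorOp T f = tensorOp T g := by
  have key : ∀ (l : List (Fin d)) (x : Fin d → ℝ), (∀ j, j ∉ l → x j ∈ F j) →
      l.foldr (fun j g => actOn (T j) j g) f x = l.foldr (fun j g => actOn (T j) j g) g x := by
    intro l
    induction l with
    | nil => intro x hx; exact h x (Fintype.mem_piFinset.2 fun j => hx j (by simp))
    | cons a l ih =>
      intro x hx
      simp only [List.foldr_cons, actOn]
      rw [hT a _ _ fun t ht => ih _ fun j hj => ?_]
      by_cases hja : j = a
      · subst hja; simpa using ht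
      · rw [Function.update_of_ne hja]
        exact hx j (by simp [hja, hj])
  funext x
  exact key _ x fun j hj => absurd (List.mem_finRange j) hj

/-- The number of distinct nodes of the sparse grid is an admissible number of point
evaluations. -/
lemma usesPointEvaluations_sparseGrid {d : ℕ} (α : ℕ) (n : ℕ → ℕ) (Λ : Finset (Fin d → ℕ)) :
    UsesPointEvaluations α (sparseGrid n Λ).card (sparseInterp n Λ) := by
  classical
  have hdet : ∀ f g : (Fin d → ℝ) → ℝ, (∀ x ∈ sparseGrid n Λ, f x = g x) →
      sparseInterp n Λ f = sparseInterp n Λ g := by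
    intro f g h
    refine Finset.sum_congr rfl fun ℓ hℓ => tensorOp_congr _
      (fun j => uniNodes n (ℓ j) ∪ uniNodes n (ℓ j - 1)) (fun j u v huv => ?_)
      fun x hx => h x (Finset.mem_biUnion.2 ⟨ℓ, hℓ, hx⟩)
    rw [LinearMap.sub_apply, LinearMap.sub_apply,
      uniInterp_congr n _ fun t ht => huv t (Finset.mem_union_left _ ht),
      uniInterp_congr n _ fun t ht => huv t (Finset.mem_union_right _ ht)]
  let e := (sparseGrid n Λ).equivFin
  refine ⟨fun i => (e.symm i : Fin d → ℝ), fun v => sparseInterp n Λ fun x =>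
    if hx : x ∈ sparseGrid n Λ then v (e ⟨x, hx⟩) else 0, fun f _ => hdet _ _ fun x hx => ?_⟩
  simp [hx]

/-- The worst-case error `sup_{0 ≠ f ∈ H^α_ρ} ‖f - A f‖_{L¹_ρ} / ‖f‖_{H^α_ρ}`, as an extended
real. -/
def worstCaseError {d : ℕ} (α : ℕ) (A : ((Fin d → ℝ) → ℝ) → (Fin d → ℝ) → ℝ) : ℝ≥0∞ :=
  ⨆ (f : (Fin d → ℝ) → ℝ) (_ : f ∈ sobolevSpace d α) (_ : f ≠ 0),
    eLpNorm (f - A f) 1 (gauss d) / sobolevNorm α f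

end SparseGH

end

/-! The lower bounds come from a function of one variable, $f(x)=g(x_j)$. On such $f$ the
sparse-grid operator collapses to the univariate interpolation of level $K$, where $K$ is the
largest level on the $j$-th axis of the index set (`sparseInterp_comp_eval`): in the other
coordinates the difference operators annihilate constants at every level above $1$, and along the
axis the sum telescopes. It is therefore enough that $g$ vanish at the $m=n_K+1$ zeros of one
Hermite polynomial.

These zeros are at least $m^{-1/2}$ apart (`one_le_mul_sq_sub_of_mem_hermiteZeros`). Subtracting
from $1$ a bump of width proportional to $m^{-1/2}$ at each zero gives a $g$ whose derivatives up to
order $\alpha$ are $O(m^{\alpha/2})$ and which equals $1$ on a large part of $[0,1]$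
(`exists_hermite_fooling`). The operator maps $f$ to $0$, so the worst-case error is at least a
constant times $m^{-\alpha/2}$.

It remains to compare $m$ with $N$. An operator using $N$ point evaluations cannot reproduce more
than $N$ monomials (`card_le_of_usesPointEvaluations`). The powers $x_j^b$ with $b\le n_K$ are
reproduced, so $N\ge m$, which is (i). The isotropic operator reproduces a hyperbolic cross of
cardinality of order $M^L L^{d-1}$, while $m=O(M^L)$; hence $m(\ln N)^{d-1}=O(N)$
(`exists_mul_pow_log_le`), which is (ii). -/

namespace SparseGH

/-! ### Zeros of Hermite polynomials: reality, simplicity, separation. -/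

section Hermite
open Polynomial

lemma derivative_hermite_succ (n : ℕ) :
    derivative (hermite (n + 1)) = ((n + 1 : ℕ) : ℤ[X]) * hermite n := by
  induction n with
  | zero => simp
  | succ n ih =>
    have h : hermite (n + 2) = X * hermite (n + 1) - derivative (hermite (n + 1)) :=
      hermite_succ (n + 1)
    rw [h, derivative_sub, derivative_mul, derivative_X, ih, derivative_mul, derivative_natCast]
    have h2 := hermite_succ n
    push_cast at *
    linear_combination (-(n + 1 : ℤ[X])) * h2

lemma hermite_succ_succ (n : ℕ) :
    hermite (n + 2) = X * hermite (n + 1) - ((n + 1 : ℕ) : ℤ[X]) * hermite n := by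
  rw [← derivative_hermite_succ]; exact hermite_succ (n + 1)

lemma aeval_hermite_succ_succ {R : Type*} [CommRing R] (n : ℕ) (x : R) :
    aeval x (hermite (n + 2)) = x * aeval x (hermite (n + 1)) - (n + 1) * aeval x (hermite n) := by
  rw [hermite_succ_succ]; simp

/-- The Christoffel–Darboux formula. -/
lemma christoffelDarboux (z w : ℂ) (n : ℕ) :
    (z - w) * ∑ k ∈ Finset.range (n + 1),
        aeval z (hermite k) * aeval w (hermite k) / (k.factorial : ℂ) =
      (aeval z (hermite (n + 1)) * aeval w (hermite n) -
        aeval z (hermite n) * aeval w (hermite (n + 1))) / (n.factorial : ℂ) := by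
  induction n with
  | zero => simp
  | succ n ih =>
    rw [Finset.sum_range_succ, mul_add, ih, aeval_hermite_succ_succ, aeval_hermite_succ_succ,
      Nat.factorial_succ]
    have h1 : (n.factorial : ℂ) ≠ 0 := by exact_mod_cast n.factorial_ne_zero
    have h2 : ((n : ℂ) + 1) ≠ 0 := by exact_mod_cast n.succ_ne_zero
    push_cast
    field_simp
    ring

/-- Christoffel–Darboux with $w=\bar z$: at a zero the right-hand side vanishes, while the sum on
the left is $\sum_k |H_k(z)|^2/k!$, which is positive because $H_0=1$. Hence $z=\bar z$. -/
lemma im_eq_zero_of_aeval_hermite (n : ℕ) {z : ℂ} (hz : aeval z (hermite n) = 0) : z.im = 0 := by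
  cases n with
  | zero => simp at hz
  | succ n =>
    have conj : ∀ k, aeval ((starRingEnd ℂ) z) (hermite k) =
        (starRingEnd ℂ) (aeval z (hermite k)) := fun k => by
      simp only [aeval_def, hom_eval₂]
      congr 1
      exact RingHom.ext_int _ _
    have h := christoffelDarboux z ((starRingEnd ℂ) z) n
    rw [conj, conj, hz, map_zero, zero_mul, mul_zero, sub_zero, zero_div] at h
    rcases mul_eq_zero.1 h with h | h
    · exact Complex.conj_eq_iff_im.1 (sub_eq_zero.1 h).symm
    · exfalso
      have h3 : ∑ k ∈ Finset.range (n + 1), Complex.normSq (aeval z (hermite k)) /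
          (k.factorial : ℝ) = 0 := by
        apply Complex.ofReal_injective
        rw [Complex.ofReal_zero, ← h, Complex.ofReal_sum]
        refine Finset.sum_congr rfl fun k _ => ?_
        rw [conj, Complex.mul_conj]
        push_cast
        rfl
      have h4 := (Finset.sum_eq_zero_iff_of_nonneg fun k _ => by
        exact div_nonneg (Complex.normSq_nonneg _) (Nat.cast_nonneg _)).1 h3 0 (by simp)
      simp at h4

/-- The Hermite polynomial with real coefficients. -/
noncomputable def realHermite (m : ℕ) : ℝ[X] := (hermite m).map (Int.castRingHom ℝ)

lemma eval_realHermite (m : ℕ) (x : ℝ) : (realHermite m).eval x = aeval x (hermite m) := by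
  rw [realHermite, eval_map, aeval_def]; rfl

lemma monic_realHermite (m : ℕ) : (realHermite m).Monic := (hermite_monic m).map _

lemma natDegree_realHermite (m : ℕ) : (realHermite m).natDegree = m := by
  rw [realHermite, (hermite_monic m).natDegree_map, natDegree_hermite]

lemma splits_realHermite (m : ℕ) : (realHermite m).Splits := by
  refine Splits.of_splits_map (algebraMap ℝ ℂ) (IsAlgClosed.splits _) fun z hz => ?_
  have hz' := (mem_roots'.1 hz).2
  rw [IsRoot, realHermite, Polynomial.map_map, eval_map] at hz'
  refine ⟨z.re, Complex.ext (by simp) ?_⟩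
  have : aeval z (hermite m) = 0 := by
    rw [← hz', aeval_def]; congr 1
  simpa using (im_eq_zero_of_aeval_hermite m this).symm

lemma derivative_realHermite_succ (m : ℕ) :
    derivative (realHermite (m + 1)) = C ((m : ℝ) + 1) * realHermite m := by
  rw [realHermite, derivative_map, derivative_hermite_succ]
  simp [realHermite]

lemma realHermite_succ (m : ℕ) :
    realHermite (m + 1) = X * realHermite m - derivative (realHermite m) := by
  simp [realHermite, hermite_succ, derivative_map]

/-- The Hermite differential equation. -/
lemma derivative_derivative_realHermite (m : ℕ) :
    derivative (derivative (realHermite m)) =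
      X * derivative (realHermite m) - C (m : ℝ) * realHermite m := by
  have h := congrArg derivative (realHermite_succ m)
  rw [derivative_realHermite_succ, derivative_sub, derivative_mul, derivative_X, C_add, C_1] at h
  linear_combination h

lemma not_aeval_hermite_eq_zero (x : ℝ) (m : ℕ) :
    ¬ (aeval x (hermite m) = 0 ∧ aeval x (hermite (m + 1)) = 0) := by
  induction m with
  | zero => simp
  | succ m ih =>
    rintro ⟨h1, h2⟩
    rw [aeval_hermite_succ_succ, h1] at h2
    have : (m : ℝ) + 1 ≠ 0 := by positivity
    exact ih ⟨by simpa [this] using h2, h1⟩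

lemma nodup_roots_realHermite (m : ℕ) : (realHermite m).roots.Nodup := by
  cases m with
  | zero => simp [realHermite]
  | succ m =>
    rw [Multiset.nodup_iff_count_le_one]
    intro x
    rw [count_roots]
    by_contra! h
    have := (one_lt_rootMultiplicity_iff_isRoot (monic_realHermite (m + 1)).ne_zero).1 h
    rw [derivative_realHermite_succ, IsRoot, IsRoot, eval_mul, eval_C, eval_realHermite,
      eval_realHermite] at this
    have h0 : (m : ℝ) + 1 ≠ 0 := by positivity
    exact not_aeval_hermite_eq_zero x m ⟨by simpa [h0] using this.2, this.1⟩

lemma hermiteZeros_val (m : ℕ) : (hermiteZeros m).val = (realHermite m).roots := by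
  rw [← (nodup_roots_realHermite m).dedup]; rfl

lemma card_hermiteZeros (m : ℕ) : (hermiteZeros m).card = m := by
  have h := (splits_iff_card_roots.1 (splits_realHermite m)).trans (natDegree_realHermite m)
  rw [Finset.card, hermiteZeros_val, h]

lemma realHermite_eq_prod (m : ℕ) : realHermite m = ∏ z ∈ hermiteZeros m, (X - C z) := by
  have h := (splits_realHermite m).eq_prod_roots_of_monic (monic_realHermite m)
  rw [Finset.prod, hermiteZeros_val, ← h]

/-- Away from the zeros, $G'^2-G''G=G^2\sum_{z\in S}(x-z)^{-2}$, and the sum dominates each of its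
terms. With denominators cleared, this follows by induction on the number of factors. -/
lemma sq_eval_derivative_prod_sub_ge (S : Finset ℝ) (x : ℝ) :
    ∀ G : ℝ[X], G = ∏ z ∈ S, (X - C z) →
      0 ≤ (derivative G).eval x ^ 2 - (derivative (derivative G)).eval x * G.eval x ∧
      ∀ z ∈ S, G.eval x ^ 2 ≤ (x - z) ^ 2 *
        ((derivative G).eval x ^ 2 - (derivative (derivative G)).eval x * G.eval x) := by
  induction S using Finset.induction_on with
  | empty => rintro G rfl; simp
  | insert a S ha ih =>
    rintro G hG
    obtain ⟨h1, h2⟩ := ih _ rfl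
    rw [Finset.prod_insert ha] at hG
    set P := ∏ z ∈ S, (X - C z) with hP
    have key : (derivative G).eval x ^ 2 - (derivative (derivative G)).eval x * G.eval x =
        P.eval x ^ 2 + (x - a) ^ 2 * ((derivative P).eval x ^ 2 -
          (derivative (derivative P)).eval x * P.eval x) := by
      rw [hG]; simp [derivative_mul]; ring
    have hGx : G.eval x = (x - a) * P.eval x := by rw [hG]; simp
    rw [key]
    refine ⟨by positivity, fun z hz => ?_⟩
    rw [hGx]
    rcases Finset.mem_insert.1 hz with rfl | hz
    · have := mul_nonneg (sq_nonneg ((x - z) ^ 2)) h1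
      nlinarith
    · have := mul_le_mul_of_nonneg_left (h2 z hz) (sq_nonneg (x - a))
      have h3 := mul_nonneg (sq_nonneg (x - z)) (sq_nonneg (P.eval x))
      nlinarith

/-- Distinct zeros of the Hermite polynomial of degree `m` are at least `m ^ (-1/2)` apart. -/
lemma one_le_mul_sq_sub_of_mem_hermiteZeros {m : ℕ} {x z : ℝ} (hx : x ∈ hermiteZeros m)
    (hz : z ∈ hermiteZeros m) (hne : x ≠ z) : 1 ≤ (m : ℝ) * (x - z) ^ 2 := by
  set G := ∏ w ∈ (hermiteZeros m).erase x, (X - C w) with hG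
  have hH : realHermite m = (X - C x) * G := by
    rw [realHermite_eq_prod, hG, Finset.mul_prod_erase _ (fun w => X - C w) hx]
  obtain ⟨h1, h2⟩ := sq_eval_derivative_prod_sub_ge _ x G hG
  have h3 := h2 z (Finset.mem_erase.2 ⟨hne.symm, hz⟩)
  have hG0 : G.eval x ≠ 0 := by
    rw [hG, eval_prod, Finset.prod_ne_zero_iff]
    intro w hw
    simpa [sub_eq_zero] using (Finset.ne_of_mem_erase hw).symm
  -- With $H=(X-x)G$, the Hermite equation and its derivative, evaluated at the zero $x$, express
  -- $G'(x)$ and $G''(x)$ through $G(x)$. They give $\sum_z (x-z)^{-2}=(m-1)/3-x^2/12$ over the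
  -- other zeros $z$, so each term is at most $m$.
  have ode := derivative_derivative_realHermite m
  have e1 := congrArg (eval x) ode
  have e2 := congrArg (eval x) (congrArg derivative ode)
  rw [hH] at e1 e2
  simp [derivative_mul] at e1 e2
  set g0 := G.eval x
  set g1 := (derivative G).eval x
  set g2 := (derivative (derivative G)).eval x
  have e1' : g1 = x * g0 / 2 := by linarith
  have e2' : g2 = (x ^ 2 + 1 - m) * g0 / 3 := by rw [e1'] at e2; linarith
  have key : g1 ^ 2 - g2 * g0 ≤ m * g0 ^ 2 := by
    rw [e1', e2']
    nlinarith [mul_nonneg (sq_nonneg x) (sq_nonneg g0), sq_nonneg g0,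
      mul_nonneg (Nat.cast_nonneg (α := ℝ) m) (sq_nonneg g0)]
  have h4 : 0 < g0 ^ 2 := by positivity
  have h5 := mul_le_mul_of_nonneg_left key (sq_nonneg (x - z))
  by_contra! h6
  nlinarith

end Hermite
-- Weak derivatives of smooth functions and bounds for the Sobolev norm.
section WeakDeriv

lemma contDiff_partialDeriv {d : ℕ} (j : Fin d) {φ : (Fin d → ℝ) → ℝ} (hφ : ContDiff ℝ ∞ φ) :
    ContDiff ℝ ∞ (partialDeriv j φ) :=
  (hφ.fderiv_right (m := ∞) (by simp)).clm_apply contDiff_const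

lemma contDiff_iterate_partialDeriv {d : ℕ} (j : Fin d) (k : ℕ) {φ : (Fin d → ℝ) → ℝ}
    (hφ : ContDiff ℝ ∞ φ) : ContDiff ℝ ∞ ((partialDeriv j)^[k] φ) := by
  induction k with
  | zero => exact hφ
  | succ k ih => rw [Function.iterate_succ_apply']; exact contDiff_partialDeriv j ih

lemma hasCompactSupport_partialDeriv {d : ℕ} (j : Fin d) {φ : (Fin d → ℝ) → ℝ}
    (hφ : HasCompactSupport φ) : HasCompactSupport (partialDeriv j φ) :=
  (hφ.fderiv ℝ).comp_left (g := fun L : (Fin d → ℝ) →L[ℝ] ℝ => L (Pi.single j 1)) rfl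

lemma hasCompactSupport_iterate_partialDeriv {d : ℕ} (j : Fin d) (k : ℕ) {φ : (Fin d → ℝ) → ℝ}
    (hφ : HasCompactSupport φ) : HasCompactSupport ((partialDeriv j)^[k] φ) := by
  induction k with
  | zero => exact hφ
  | succ k ih => rw [Function.iterate_succ_apply']; exact hasCompactSupport_partialDeriv j ih

lemma integral_mul_partialDeriv {d : ℕ} (j : Fin d) {f φ : (Fin d → ℝ) → ℝ}
    (hf : ContDiff ℝ ∞ f) (hφ : ContDiff ℝ ∞ φ) (hc : HasCompactSupport φ) :
    ∫ x, f x * partialDeriv j φ x = - ∫ x, partialDeriv j f x * φ x := by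
  refine integral_mul_fderiv_eq_neg_fderiv_mul_of_integrable ?_ ?_ ?_ ?_ ?_
  · exact ((contDiff_partialDeriv j hf).continuous.mul hφ.continuous).integrable_of_hasCompactSupport
      hc.mul_left
  · exact (hf.continuous.mul (contDiff_partialDeriv j hφ).continuous).integrable_of_hasCompactSupport
      (hasCompactSupport_partialDeriv j hc).mul_left
  · exact (hf.continuous.mul hφ.continuous).integrable_of_hasCompactSupport hc.mul_left
  · exact fun x _ => (hf.differentiable (by simp)) x
  · exact fun x _ => (hφ.differentiable (by simp)) x

lemma integral_mul_iterate_partialDeriv {d : ℕ} (j : Fin d) (k : ℕ) :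
    ∀ {f φ : (Fin d → ℝ) → ℝ}, ContDiff ℝ ∞ f → ContDiff ℝ ∞ φ → HasCompactSupport φ →
    ∫ x, f x * (partialDeriv j)^[k] φ x = (-1) ^ k * ∫ x, (partialDeriv j)^[k] f x * φ x := by
  induction k with
  | zero => intros; simp
  | succ k ih =>
    intro f φ hf hφ hc
    rw [Function.iterate_succ_apply', integral_mul_partialDeriv j hf
      (contDiff_iterate_partialDeriv j k hφ) (hasCompactSupport_iterate_partialDeriv j k hc),
      ih (contDiff_partialDeriv j hf) hφ hc, Function.iterate_succ_apply, pow_succ]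
    ring

/-- The derivative `D^r f` of a smooth function, the partial derivatives being taken in the order
that is opposite to the one of `multiDeriv`. -/
noncomputable def revDeriv {d : ℕ} (r : Fin d → ℕ) (f : (Fin d → ℝ) → ℝ) : (Fin d → ℝ) → ℝ :=
  (List.finRange d).foldl (fun ψ j => (partialDeriv j)^[r j] ψ) f

lemma contDiff_foldl {d : ℕ} (r : Fin d → ℕ) (l : List (Fin d)) :
    ∀ {f : (Fin d → ℝ) → ℝ}, ContDiff ℝ ∞ f →
      ContDiff ℝ ∞ (l.foldl (fun ψ j => (partialDeriv j)^[r j] ψ) f) := by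
  induction l with
  | nil => exact fun h => h
  | cons a l ih => exact fun h => ih (contDiff_iterate_partialDeriv a _ h)

lemma hasCompactSupport_foldl {d : ℕ} (r : Fin d → ℕ) (l : List (Fin d)) :
    ∀ {f : (Fin d → ℝ) → ℝ}, HasCompactSupport f →
      HasCompactSupport (l.foldl (fun ψ j => (partialDeriv j)^[r j] ψ) f) := by
  induction l with
  | nil => exact fun h => h
  | cons a l ih => exact fun h => ih (hasCompactSupport_iterate_partialDeriv a _ h)

lemma contDiff_hasCompactSupport_foldr {d : ℕ} (r : Fin d → ℕ) (l : List (Fin d))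
    {φ : (Fin d → ℝ) → ℝ} (hφ : ContDiff ℝ ∞ φ) (hc : HasCompactSupport φ) :
    ContDiff ℝ ∞ (l.foldr (fun j ψ => (partialDeriv j)^[r j] ψ) φ) ∧
      HasCompactSupport (l.foldr (fun j ψ => (partialDeriv j)^[r j] ψ) φ) := by
  induction l with
  | nil => exact ⟨hφ, hc⟩
  | cons a l ih => exact ⟨contDiff_iterate_partialDeriv a _ ih.1,
      hasCompactSupport_iterate_partialDeriv a _ ih.2⟩

/-- Integration by parts removes the outermost derivative of $\varphi$ and makes it the innermost
one of $f$; this is why the fold changes direction. Commutation of partial derivatives is thereby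
avoided. -/
lemma integral_mul_foldr {d : ℕ} (r : Fin d → ℕ) (l : List (Fin d)) {φ : (Fin d → ℝ) → ℝ}
    (hφ : ContDiff ℝ ∞ φ) (hc : HasCompactSupport φ) :
    ∀ {f : (Fin d → ℝ) → ℝ}, ContDiff ℝ ∞ f →
      ∫ x, f x * l.foldr (fun j ψ => (partialDeriv j)^[r j] ψ) φ x =
        (-1) ^ (l.map r).sum *
          ∫ x, l.foldl (fun ψ j => (partialDeriv j)^[r j] ψ) f x * φ x := by
  induction l with
  | nil => intros; simp
  | cons a l ih =>
    intro f hf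
    obtain ⟨h1, h2⟩ := contDiff_hasCompactSupport_foldr r l hφ hc
    simp only [List.foldr_cons, List.foldl_cons, List.map_cons, List.sum_cons]
    rw [integral_mul_iterate_partialDeriv a _ hf h1 h2,
      ih (contDiff_iterate_partialDeriv a _ hf), pow_add, mul_assoc]

lemma isWeakDeriv_revDeriv {d : ℕ} (r : Fin d → ℕ) {f : (Fin d → ℝ) → ℝ}
    (hf : ContDiff ℝ ∞ f) : IsWeakDeriv r f (revDeriv r f) := by
  refine ⟨hf.continuous.locallyIntegrable, (contDiff_foldl r _ hf).continuous.locallyIntegrable,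
    fun φ hφ hc => ?_⟩
  rw [multiDeriv, integral_mul_foldr r _ hφ hc hf]
  have : (List.map r (List.finRange d)).sum = ∑ j, r j := by
    rw [← List.ofFn_eq_map, List.sum_ofFn]
  rw [this]
  rfl

lemma integrable_rho (d : ℕ) : Integrable (rho (d := d)) := by
  have h : (rho (d := d)) = fun x => (∏ j, Real.exp (-(1 / 2) * x j ^ 2)) /
      (2 * Real.pi) ^ ((d : ℝ) / 2) := by
    funext x
    rw [rho, ← Real.exp_sum]
    congr 2
    rw [← Finset.mul_sum]
    ring
  rw [h]
  exact (Integrable.fintype_prod (f := fun _ t => Real.exp (-(1 / 2) * t ^ 2))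
    fun _ => integrable_exp_neg_mul_sq (by norm_num)).div_const _

instance isFiniteMeasure_gauss (d : ℕ) : IsFiniteMeasure (gauss d) :=
  isFiniteMeasure_withDensity_ofReal (integrable_rho d).2

/-- The Gaussian measure is finite, so a uniform bound suffices; this covers $g(x_j)$, which need
not decay. -/
lemma weakDerivNorm_le {d : ℕ} {r : Fin d → ℕ} {f : (Fin d → ℝ) → ℝ} (hf : ContDiff ℝ ∞ f)
    {B : ℝ} (hB : ∀ x, |revDeriv r f x| ≤ B) :
    weakDerivNorm r f ≤ gauss d Set.univ ^ (1 / 2 : ℝ) * ENNReal.ofReal B := by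
  refine (iInf₂_le _ (isWeakDeriv_revDeriv r hf)).trans ?_
  have := eLpNorm_le_of_ae_bound (μ := gauss d) (p := 2) (f := revDeriv r f) (C := B)
    (Filter.Eventually.of_forall hB)
  simpa using this

lemma sobolevNorm_le {d α : ℕ} {f : (Fin d → ℝ) → ℝ} {B : ℝ≥0∞}
    (hB : ∀ r : Fin d → Fin (α + 1), weakDerivNorm (fun j => (r j : ℕ)) f ≤ B) :
    sobolevNorm α f ≤ (((α + 1) ^ d : ℕ) : ℝ≥0∞) ^ (1 / 2 : ℝ) * B := by
  have h1 : ∑ r : Fin d → Fin (α + 1), weakDerivNorm (fun j => (r j : ℕ)) f ^ 2 ≤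
      (((α + 1) ^ d : ℕ) : ℝ≥0∞) * B ^ 2 := by
    refine (Finset.sum_le_card_nsmul _ _ (B ^ 2) fun r _ => by gcongr; exact hB r).trans ?_
    simp
  refine (ENNReal.rpow_le_rpow h1 (by norm_num)).trans ?_
  rw [ENNReal.mul_rpow_of_nonneg _ _ (by norm_num), ← ENNReal.rpow_natCast B 2, ← ENNReal.rpow_mul]
  norm_num

lemma mem_sobolevSpace_of_hasCompactSupport {d : ℕ} (α : ℕ) {f : (Fin d → ℝ) → ℝ}
    (hf : ContDiff ℝ ∞ f) (hc : HasCompactSupport f) : f ∈ sobolevSpace d α := by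
  refine ⟨hf.continuous, ?_⟩
  have h : ∀ r : Fin d → Fin (α + 1), weakDerivNorm (fun j => (r j : ℕ)) f < ⊤ := fun r => by
    obtain ⟨B, hB⟩ := (hasCompactSupport_foldl (fun j => (r j : ℕ)) _ hc).exists_bound_of_continuous
      (contDiff_foldl _ (List.finRange d) hf).continuous
    refine (weakDerivNorm_le hf (B := B) hB).trans_lt ?_
    exact ENNReal.mul_lt_top (ENNReal.rpow_lt_top_of_nonneg (by norm_num)
      (measure_ne_top _ _)) ENNReal.ofReal_lt_top
  refine ENNReal.rpow_lt_top_of_nonneg (by norm_num) ?_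
  exact (ENNReal.sum_lt_top.2 fun r _ => ENNReal.pow_lt_top (h r)).ne

end WeakDeriv
-- Functions of a single coordinate.
section OneVariable

lemma partialDeriv_zero {d : ℕ} (i : Fin d) :
    partialDeriv i (fun _ => (0 : ℝ)) = fun _ => 0 := by
  funext x; simp [partialDeriv]

lemma partialDeriv_comp_eval {d : ℕ} (i j : Fin d) {h : ℝ → ℝ} (hh : Differentiable ℝ h) :
    partialDeriv i (fun x => h (x j)) = if i = j then fun x => deriv h (x j) else fun _ => 0 := by
  funext x
  have h1 : HasFDerivAt (fun x : Fin d → ℝ => h (x j))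
      (deriv h (x j) • (ContinuousLinearMap.proj (R := ℝ) (φ := fun _ : Fin d => ℝ) j)) x :=
    (hh (x j)).hasDerivAt.comp_hasFDerivAt x
      (ContinuousLinearMap.proj (R := ℝ) (φ := fun _ : Fin d => ℝ) j).hasFDerivAt
  rw [partialDeriv, h1.fderiv]
  split_ifs with hij
  · subst hij; simp
  · simp [Ne.symm hij]

lemma iterate_partialDeriv_self {d : ℕ} (j : Fin d) (k : ℕ) {h : ℝ → ℝ} (hh : ContDiff ℝ ∞ h) :
    (partialDeriv j)^[k] (fun x => h (x j)) = fun x => iteratedDeriv k h (x j) := by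
  induction k with
  | zero => simp
  | succ k ih =>
    rw [Function.iterate_succ_apply', ih, partialDeriv_comp_eval j j, if_pos rfl,
      iteratedDeriv_succ]
    exact hh.differentiable_iteratedDeriv k (by exact_mod_cast ENat.natCast_lt_top k)

lemma foldl_zero {d : ℕ} (r : Fin d → ℕ) (l : List (Fin d)) :
    l.foldl (fun ψ j => (partialDeriv j)^[r j] ψ) (fun _ => (0 : ℝ)) = fun _ => 0 := by
  induction l with
  | nil => rfl
  | cons a l ih =>
    have : (partialDeriv a)^[r a] (fun _ => (0 : ℝ)) = fun _ => 0 :=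
      Function.iterate_fixed (partialDeriv_zero a) _
    rw [List.foldl_cons, this, ih]

/-- A derivative in any direction other than $j$ kills the function, and those in direction $j$ are
ordinary derivatives of $h$. `Nodup` ensures that direction $j$ is met at most once. -/
lemma foldl_comp_eval {d : ℕ} (r : Fin d → ℕ) (j : Fin d) (l : List (Fin d)) :
    ∀ {h : ℝ → ℝ}, l.Nodup → ContDiff ℝ ∞ h →
      l.foldl (fun ψ j => (partialDeriv j)^[r j] ψ) (fun x => h (x j)) = (fun _ => 0) ∨
      l.foldl (fun ψ j => (partialDeriv j)^[r j] ψ) (fun x => h (x j)) =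
        fun x => iteratedDeriv (if j ∈ l then r j else 0) h (x j) := by
  induction l with
  | nil => intro h _ _; right; simp
  | cons a l ih =>
    intro h hl hh
    rw [List.nodup_cons] at hl
    rw [List.foldl_cons]
    by_cases ha : a = j
    · subst ha
      rw [iterate_partialDeriv_self a _ hh]
      have := ih (h := iteratedDeriv (r a) h) hl.2
        (by rw [iteratedDeriv_eq_iterate]; exact hh.iterate_deriv _)
      simpa [hl.1] using this
    · cases hr : r a with
      | zero =>
        have := ih hl.2 hh
        simpa [Ne.symm ha] using this
      | succ k =>
        left
        have h0 : (partialDeriv a)^[k + 1] (fun x => h (x j)) = fun _ => 0 := by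
          rw [Function.iterate_succ_apply, partialDeriv_comp_eval a j (hh.differentiable (by simp)),
            if_neg ha]
          exact Function.iterate_fixed (partialDeriv_zero a) _
        rw [h0, foldl_zero]

lemma abs_revDeriv_comp_eval_le {d : ℕ} (r : Fin d → ℕ) (j : Fin d) {g : ℝ → ℝ}
    (hg : ContDiff ℝ ∞ g) {B : ℝ} (hB : ∀ t, |iteratedDeriv (r j) g t| ≤ B) (x : Fin d → ℝ) :
    |revDeriv r (fun x => g (x j)) x| ≤ B := by
  rcases foldl_comp_eval r j _ (List.nodup_finRange d) hg with h | h
  · rw [revDeriv, h, abs_zero]; exact (abs_nonneg _).trans (hB 0)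
  · rw [revDeriv, h]; simpa using hB (x j)

lemma rho_ge {d : ℕ} {x : Fin d → ℝ} (hx : ∀ i, x i ∈ Set.Icc (0 : ℝ) 1) :
    Real.exp (-(d : ℝ) / 2) / (2 * Real.pi) ^ ((d : ℝ) / 2) ≤ rho x := by
  have h : ∑ i, x i ^ 2 ≤ d := by
    refine (Finset.sum_le_card_nsmul _ _ 1 fun i _ => ?_).trans (by simp)
    have := hx i
    exact pow_le_one₀ this.1 this.2
  unfold rho
  gcongr

/-- Restrict to the part of the unit cube where $|g(x_j)|\ge 1$: its volume is at least $1/4$, and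
the density is bounded below on the cube. -/
lemma eLpNorm_comp_eval_ge {d : ℕ} (j : Fin d) {g : ℝ → ℝ} (hg : Continuous g)
    (hvol : ENNReal.ofReal (1 / 4) ≤ volume {t : ℝ | t ∈ Set.Icc (0 : ℝ) 1 ∧ 1 ≤ |g t|}) :
    ENNReal.ofReal (Real.exp (-(d : ℝ) / 2) / (2 * Real.pi) ^ ((d : ℝ) / 2) * (1 / 4)) ≤
      eLpNorm (fun x : Fin d → ℝ => g (x j)) 1 (gauss d) := by
  set A : Set ℝ := {t : ℝ | t ∈ Set.Icc (0 : ℝ) 1 ∧ 1 ≤ |g t|} with hA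
  have hAm : MeasurableSet A :=
    measurableSet_Icc.inter (isClosed_le continuous_const hg.abs).measurableSet
  set S : Set (Fin d → ℝ) := Set.pi Set.univ (fun i => if i = j then A else Set.Icc 0 1) with hS
  have hSm : MeasurableSet S := MeasurableSet.univ_pi fun i => by
    split_ifs
    exacts [hAm, measurableSet_Icc]
  have hmem : ∀ x ∈ S, (∀ i, x i ∈ Set.Icc (0 : ℝ) 1) ∧ 1 ≤ |g (x j)| := fun x hx => by
    refine ⟨fun i => ?_, ?_⟩
    · have := hx i (Set.mem_univ i)
      dsimp only at this
      split_ifs at this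
      exacts [this.1, this]
    · have := hx j (Set.mem_univ j)
      simp only [if_true] at this
      exact this.2
  have hvS : ENNReal.ofReal (1 / 4) ≤ volume S := by
    rw [hS, volume_pi_pi, ← Finset.mul_prod_erase _ _ (Finset.mem_univ j), if_pos rfl,
      Finset.prod_eq_one, mul_one]
    · exact hvol
    · intro i hi
      rw [if_neg (Finset.ne_of_mem_erase hi), Real.volume_Icc]
      simp
  rw [eLpNorm_one_eq_lintegral_enorm]
  calc _ = ENNReal.ofReal (Real.exp (-(d : ℝ) / 2) / (2 * Real.pi) ^ ((d : ℝ) / 2)) *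
        ENNReal.ofReal (1 / 4) := ENNReal.ofReal_mul (by positivity)
    _ ≤ ENNReal.ofReal (Real.exp (-(d : ℝ) / 2) / (2 * Real.pi) ^ ((d : ℝ) / 2)) * volume S := by
        gcongr
    _ = ∫⁻ _ in S, ENNReal.ofReal (Real.exp (-(d : ℝ) / 2) / (2 * Real.pi) ^ ((d : ℝ) / 2)) := by
        rw [setLIntegral_const]
    _ ≤ ∫⁻ x in S, ENNReal.ofReal (rho x) :=
        setLIntegral_mono' hSm fun x hx => ENNReal.ofReal_le_ofReal (rho_ge (hmem x hx).1)
    _ = ∫⁻ _ in S, 1 ∂(gauss d) := by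
        rw [setLIntegral_const, one_mul, gauss, withDensity_apply _ hSm]
    _ ≤ ∫⁻ x in S, ‖g (x j)‖ₑ ∂(gauss d) := by
        refine setLIntegral_mono' hSm fun x hx => ?_
        rw [Real.enorm_eq_ofReal_abs, ← ENNReal.ofReal_one]
        exact ENNReal.ofReal_le_ofReal (hmem x hx).2
    _ ≤ _ := setLIntegral_le_lintegral _ _

/-- A function of a single variable that an operator maps to zero yields a lower bound for the
worst-case error. -/
lemma exists_worstCaseError_ge (d α : ℕ) : ∃ κ : ℝ, 0 < κ ∧
    ∀ (A : ((Fin d → ℝ) → ℝ) → (Fin d → ℝ) → ℝ) (j : Fin d) (g : ℝ → ℝ) (B : ℝ), 0 < B →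
      ContDiff ℝ ∞ g → (∀ k ≤ α, ∀ t, |iteratedDeriv k g t| ≤ B) →
      ENNReal.ofReal (1 / 4) ≤ volume {t : ℝ | t ∈ Set.Icc (0 : ℝ) 1 ∧ 1 ≤ |g t|} →
      A (fun x => g (x j)) = 0 → ENNReal.ofReal (κ / B) ≤ worstCaseError α A := by
  set a : ℝ := Real.exp (-(d : ℝ) / 2) / (2 * Real.pi) ^ ((d : ℝ) / 2) * (1 / 4) with ha
  have ha0 : 0 < a := by positivity
  set D : ℝ≥0∞ := (((α + 1) ^ d : ℕ) : ℝ≥0∞) ^ (1 / 2 : ℝ) * gauss d Set.univ ^ (1 / 2 : ℝ) with hD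
  have hDt : D ≠ ⊤ := ENNReal.mul_ne_top
    (ENNReal.rpow_ne_top_of_nonneg (by norm_num) (ENNReal.natCast_ne_top _))
    (ENNReal.rpow_ne_top_of_nonneg (by norm_num) (measure_ne_top _ _))
  -- The added $1$ makes the denominator positive without a lower bound on the Gaussian mass.
  refine ⟨a / (D.toReal + 1), by positivity, fun A j g B hB hg hgB hvol hA => ?_⟩
  have hf : ContDiff ℝ ∞ (fun x : Fin d → ℝ => g (x j)) := hg.comp (contDiff_apply ℝ ℝ j)
  have hnorm : sobolevNorm α (fun x : Fin d → ℝ => g (x j)) ≤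
      ENNReal.ofReal ((D.toReal + 1) * B) := by
    have h1 := sobolevNorm_le (α := α) (f := fun x : Fin d → ℝ => g (x j)) fun r =>
      weakDerivNorm_le hf (abs_revDeriv_comp_eval_le (fun i => (r i : ℕ)) j hg
        (hgB (r j) (Nat.lt_succ_iff.1 (r j).2)))
    refine h1.trans ?_
    rw [← mul_assoc, ENNReal.ofReal_mul (by positivity), ← hD]
    gcongr
    exact (ENNReal.ofReal_toReal hDt).ge.trans (ENNReal.ofReal_le_ofReal (by linarith))
  have hmem : (fun x : Fin d → ℝ => g (x j)) ∈ sobolevSpace d α :=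
    ⟨hf.continuous, hnorm.trans_lt ENNReal.ofReal_lt_top⟩
  have hne : (fun x : Fin d → ℝ => g (x j)) ≠ 0 := fun h0 => by
    have : {t : ℝ | t ∈ Set.Icc (0 : ℝ) 1 ∧ 1 ≤ |g t|} = ∅ := by
      refine Set.eq_empty_of_forall_notMem fun t ht => ?_
      have h2 := congrFun h0 (fun _ => t)
      simp only [Pi.zero_apply] at h2
      have := ht.2
      rw [h2, abs_zero] at this
      linarith
    rw [this, measure_empty] at hvol
    norm_num at hvol
  calc ENNReal.ofReal (a / (D.toReal + 1) / B)
      = ENNReal.ofReal a / ENNReal.ofReal ((D.toReal + 1) * B) := by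
        rw [div_div, ENNReal.ofReal_div_of_pos (by positivity)]
    _ ≤ eLpNorm ((fun x : Fin d → ℝ => g (x j)) - A (fun x => g (x j))) 1 (gauss d) /
          sobolevNorm α (fun x : Fin d → ℝ => g (x j)) := by
        rw [hA, sub_zero]
        exact ENNReal.div_le_div (eLpNorm_comp_eval_ge j hg.continuous hvol) hnorm
    _ ≤ _ := by
        unfold worstCaseError
        exact le_iSup₂_of_le _ hmem (le_iSup_of_le hne le_rfl)

end OneVariable

/-! ### The fooling function. -/

section Fooling

lemma iteratedDeriv_scaled {η : ℝ → ℝ} (hη : ContDiff ℝ ∞ η) (k : ℕ) (b z : ℝ) :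
    iteratedDeriv k (fun t => η (b * (t - z))) =
      fun t => b ^ k * iteratedDeriv k η (b * (t - z)) := by
  have h1 := iteratedDeriv_comp_sub_const k (fun t => η (b * t)) z
  rw [h1, iteratedDeriv_comp_const_mul (hη.of_le (by exact_mod_cast le_top))]

lemma iteratedDeriv_eq_zero_of_notMem_tsupport {η : ℝ → ℝ} {k : ℕ} {t : ℝ}
    (h : t ∉ tsupport η) : iteratedDeriv k η t = 0 := by
  have h1 : η =ᶠ[nhds t] fun _ => 0 := notMem_tsupport_iff_eventuallyEq.1 h
  rw [h1.iteratedDeriv_eq]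
  simp

/-- For sums of bumps with disjoint supports: at most one term is nonzero, so the bound does not
depend on the number of bumps. -/
lemma abs_sum_le_of_subsingleton {ι : Type*} (s : Finset ι) (F : ι → ℝ) {b : ℝ} (hb : 0 ≤ b)
    (hF : ∀ i ∈ s, |F i| ≤ b) (hs : ∀ i ∈ s, ∀ j ∈ s, F i ≠ 0 → F j ≠ 0 → i = j) :
    |∑ i ∈ s, F i| ≤ b := by
  by_cases h : ∃ i ∈ s, F i ≠ 0
  · obtain ⟨i, hi, hi0⟩ := h
    rw [Finset.sum_eq_single_of_mem i hi]
    · exact hF i hi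
    · intro j hj hji
      by_contra h0
      exact hji (hs j hj i hi h0 hi0)
  · push Not at h
    rw [Finset.sum_eq_zero h, abs_zero]
    exact hb

/-- The intervals $[z,z+\delta)$ are disjoint and lie in $[-1,3]$. -/
lemma card_mul_le_of_separated {Z : Finset ℝ} {δ : ℝ} (hδ1 : δ ≤ 1)
    (hZ : ∀ x ∈ Z, x ∈ Set.Icc (-1 : ℝ) 2)
    (hsep : ∀ x ∈ Z, ∀ y ∈ Z, x ≠ y → δ ≤ |x - y|) : (Z.card : ℝ) * δ ≤ 4 := by
  have h1 : volume (⋃ z ∈ Z, Set.Ico z (z + δ)) = ∑ z ∈ Z, volume (Set.Ico z (z + δ)) := by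
    refine measure_biUnion_finset (fun x hx y hy hxy => ?_) fun _ _ => measurableSet_Ico
    refine Set.disjoint_left.2 fun t ht ht' => ?_
    have := hsep x hx y hy hxy
    rcases abs_cases (x - y) with h | h <;> linarith [ht.1, ht.2, ht'.1, ht'.2]
  have h2 : volume (⋃ z ∈ Z, Set.Ico z (z + δ)) ≤ volume (Set.Icc (-1 : ℝ) 3) := by
    refine measure_mono (Set.iUnion₂_subset fun z hz t ht => ?_)
    have := hZ z hz
    exact ⟨by linarith [this.1, ht.1], by linarith [this.2, ht.2]⟩
  rw [h1] at h2
  simp only [Real.volume_Ico, add_sub_cancel_left, Finset.sum_const, nsmul_eq_mul,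
    Real.volume_Icc] at h2
  rw [← ENNReal.ofReal_natCast, ← ENNReal.ofReal_mul (by positivity),
    ENNReal.ofReal_le_ofReal_iff (by norm_num)] at h2
  linarith

/-- For every `δ`-separated finite set there is a smooth function that vanishes on it, equals `1` on
a large part of the unit interval, and has derivatives of the order `δ ^ (-k)`. -/
lemma exists_fooling (α : ℕ) : ∃ C : ℝ, 0 < C ∧ ∀ (Z : Finset ℝ) (δ : ℝ), 0 < δ → δ ≤ 1 →
    (∀ x ∈ Z, ∀ y ∈ Z, x ≠ y → δ ≤ |x - y|) →
    ∃ g : ℝ → ℝ, ContDiff ℝ ∞ g ∧ (∀ z ∈ Z, g z = 0) ∧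
      (∀ k ≤ α, ∀ t, |iteratedDeriv k g t| ≤ C * δ⁻¹ ^ α) ∧
      ENNReal.ofReal (1 / 4) ≤ volume {t : ℝ | t ∈ Set.Icc (0 : ℝ) 1 ∧ 1 ≤ |g t|} := by
  -- After scaling, each bump lives on an interval of length $\delta/16$. At most $4/\delta$ bumps
  -- can reach $[0,1]$, so together they cover at most $1/4$ of it.
  obtain ⟨η, hη, hη0, hηs, hηc⟩ : ∃ η : ℝ → ℝ, ContDiff ℝ ∞ η ∧ η 0 = 1 ∧
      (∀ t ∈ tsupport η, |t| ≤ 1 / 32) ∧ HasCompactSupport η := by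
    let b : ContDiffBump (0 : ℝ) := ⟨1 / 64, 1 / 32, by norm_num, by norm_num⟩
    refine ⟨b, b.contDiff, b.one_of_mem_closedBall (Metric.mem_closedBall_self b.rIn_pos.le),
      fun t ht => ?_, b.hasCompactSupport⟩
    rw [b.tsupport_eq, Metric.mem_closedBall, Real.dist_eq, sub_zero] at ht
    exact ht
  have hbd : ∀ k : ℕ, ∃ C : ℝ, 0 ≤ C ∧ ∀ t, |iteratedDeriv k η t| ≤ C := fun k => by
    have hc : HasCompactSupport (iteratedDeriv k η) :=
      HasCompactSupport.intro hηc fun t ht => iteratedDeriv_eq_zero_of_notMem_tsupport ht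
    obtain ⟨C, hC⟩ := hc.exists_bound_of_continuous
      (hη.continuous_iteratedDeriv k (by exact_mod_cast le_top))
    exact ⟨C, (norm_nonneg _).trans (hC 0), hC⟩
  choose c hc0 hc using hbd
  have hcsum : ∀ k ≤ α, c k ≤ ∑ i ∈ Finset.range (α + 1), c i := fun k hk =>
    Finset.single_le_sum (fun i _ => hc0 i) (Finset.mem_range.2 (Nat.lt_succ_of_le hk))
  have hsum0 : 0 ≤ ∑ i ∈ Finset.range (α + 1), c i := Finset.sum_nonneg fun i _ => hc0 i
  refine ⟨1 + ∑ i ∈ Finset.range (α + 1), c i, by positivity, fun Z δ hδ hδ1 hsep => ?_⟩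
  have hδi : 1 ≤ δ⁻¹ := (one_le_inv₀ hδ).2 hδ1
  have hsmooth : ∀ z : ℝ, ContDiff ℝ ∞ (fun t => η (δ⁻¹ * (t - z))) := fun z =>
    hη.comp (contDiff_const.mul (contDiff_id.sub contDiff_const))
  have hclose : ∀ t z : ℝ, δ⁻¹ * (t - z) ∈ tsupport η → |t - z| ≤ δ / 32 := fun t z h => by
    have := hηs _ h
    rw [abs_mul, abs_of_pos (inv_pos.2 hδ), inv_mul_le_iff₀ hδ] at this
    linarith
  have huniq : ∀ t, ∀ x ∈ Z, ∀ y ∈ Z, δ⁻¹ * (t - x) ∈ tsupport η →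
      δ⁻¹ * (t - y) ∈ tsupport η → x = y := fun t x hx y hy h1 h2 => by
    by_contra hxy
    have h3 := hsep x hx y hy hxy
    have h4 := abs_sub_le x t y
    rw [abs_sub_comm x t] at h4
    linarith [hclose t x h1, hclose t y h2]
  refine ⟨fun t => 1 - ∑ z ∈ Z, η (δ⁻¹ * (t - z)),
    contDiff_const.sub (ContDiff.sum fun z _ => hsmooth z), fun z hz => ?_, fun k hk t => ?_, ?_⟩
  · dsimp only
    rw [Finset.sum_eq_single_of_mem z hz, sub_self, mul_zero, hη0, sub_self]
    intro w hw hwz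
    by_contra h0
    exact hwz (huniq z w hw z hz (subset_tsupport _ h0)
      (subset_tsupport _ (by simp [Function.mem_support, hη0])))
  · have h1 : iteratedDeriv k (fun t => 1 - ∑ z ∈ Z, η (δ⁻¹ * (t - z))) t =
        iteratedDeriv k (fun _ => (1 : ℝ)) t -
          ∑ z ∈ Z, δ⁻¹ ^ k * iteratedDeriv k η (δ⁻¹ * (t - z)) := by
      have e1 := iteratedDeriv_sub (n := k) (x := t) (f := fun _ : ℝ => (1 : ℝ))
        (g := fun t => ∑ z ∈ Z, η (δ⁻¹ * (t - z))) contDiffAt_const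
        (((ContDiff.sum fun z _ => hsmooth z).of_le (by exact_mod_cast le_top)).contDiffAt)
      rw [show (fun t => 1 - ∑ z ∈ Z, η (δ⁻¹ * (t - z))) =
        (fun _ : ℝ => (1 : ℝ)) - fun t => ∑ z ∈ Z, η (δ⁻¹ * (t - z)) from rfl, e1,
        iteratedDeriv_fun_sum fun z _ =>
          ((hsmooth z).of_le (by exact_mod_cast le_top)).contDiffAt]
      congr 1
      exact Finset.sum_congr rfl fun z _ => congrFun (iteratedDeriv_scaled hη k δ⁻¹ z) t
    have h2 : |iteratedDeriv k (fun _ : ℝ => (1 : ℝ)) t| ≤ 1 := by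
      rw [iteratedDeriv_const]
      split_ifs <;> simp
    have hpow : δ⁻¹ ^ k ≤ δ⁻¹ ^ α := pow_le_pow_right₀ hδi hk
    have h3 : |∑ z ∈ Z, δ⁻¹ ^ k * iteratedDeriv k η (δ⁻¹ * (t - z))| ≤
        δ⁻¹ ^ α * ∑ i ∈ Finset.range (α + 1), c i := by
      refine abs_sum_le_of_subsingleton _ _ (by positivity) (fun z _ => ?_)
        fun x hx y hy h1 h2 => huniq t x hx y hy ?_ ?_
      · rw [abs_mul, abs_of_pos (by positivity : 0 < δ⁻¹ ^ k)]
        exact mul_le_mul hpow ((hc k _).trans (hcsum k hk)) (abs_nonneg _) (by positivity)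
      · by_contra h
        exact h1 (by rw [iteratedDeriv_eq_zero_of_notMem_tsupport h, mul_zero])
      · by_contra h
        exact h2 (by rw [iteratedDeriv_eq_zero_of_notMem_tsupport h, mul_zero])
    rw [h1]
    refine (abs_sub _ _).trans ?_
    have h4 : 1 ≤ δ⁻¹ ^ α := one_le_pow₀ hδi
    linarith
  · set Z' := Z.filter fun z => z ∈ Set.Icc (-1 : ℝ) 2 with hZ'
    have hcard : (Z'.card : ℝ) * δ ≤ 4 := card_mul_le_of_separated hδ1
      (fun x hx => (Finset.mem_filter.1 hx).2) fun x hx y hy =>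
        hsep x (Finset.mem_filter.1 hx).1 y (Finset.mem_filter.1 hy).1
    set U : Set ℝ := ⋃ z ∈ Z', Set.Icc (z - δ / 32) (z + δ / 32) with hU
    have hvU : volume U ≤ ENNReal.ofReal (1 / 4) := by
      refine (measure_biUnion_finset_le _ _).trans ?_
      simp only [Real.volume_Icc, add_sub_sub_cancel, Finset.sum_const, nsmul_eq_mul]
      rw [← ENNReal.ofReal_natCast, ← ENNReal.ofReal_mul (by positivity)]
      refine ENNReal.ofReal_le_ofReal ?_
      linarith
    have hsub : Set.Icc (0 : ℝ) 1 \ U ⊆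
        {t : ℝ | t ∈ Set.Icc (0 : ℝ) 1 ∧ 1 ≤ |1 - ∑ z ∈ Z, η (δ⁻¹ * (t - z))|} := by
      rintro t ⟨ht, htU⟩
      refine ⟨ht, ?_⟩
      rw [Finset.sum_eq_zero, sub_zero, abs_one]
      intro z hz
      by_contra h0
      have h1 := abs_le.1 (hclose t z (subset_tsupport _ h0))
      refine htU (Set.mem_iUnion₂.2 ⟨z, Finset.mem_filter.2 ⟨hz, ?_, ?_⟩, ?_, ?_⟩) <;>
        linarith [ht.1, ht.2, h1.1, h1.2]
    refine le_trans ?_ (measure_mono hsub)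
    refine le_trans ?_ le_measure_sdiff
    rw [Real.volume_Icc]
    refine le_trans ?_ (tsub_le_tsub_left hvU _)
    rw [← ENNReal.ofReal_sub _ (by norm_num)]
    exact ENNReal.ofReal_le_ofReal (by norm_num)

/-- A fooling function for interpolation at the zeros of a Hermite polynomial. -/
lemma exists_hermite_fooling (α : ℕ) : ∃ C : ℝ, 0 < C ∧ ∀ m : ℕ, 1 ≤ m →
    ∃ g : ℝ → ℝ, ContDiff ℝ ∞ g ∧ (∀ z ∈ hermiteZeros m, g z = 0) ∧
      (∀ k ≤ α, ∀ t, |iteratedDeriv k g t| ≤ C * (m : ℝ) ^ ((α : ℝ) / 2)) ∧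
      ENNReal.ofReal (1 / 4) ≤ volume {t : ℝ | t ∈ Set.Icc (0 : ℝ) 1 ∧ 1 ≤ |g t|} := by
  obtain ⟨C, hC, h⟩ := exists_fooling α
  refine ⟨C, hC, fun m hm => ?_⟩
  have hm' : (1 : ℝ) ≤ m := by exact_mod_cast hm
  have hs : 1 ≤ √(m : ℝ) := Real.one_le_sqrt.2 hm'
  obtain ⟨g, h1, h2, h3, h4⟩ := h (hermiteZeros m) (√(m : ℝ))⁻¹ (by positivity)
    (inv_le_one_of_one_le₀ hs) fun x hx y hy hxy => by
      have := one_le_mul_sq_sub_of_mem_hermiteZeros hx hy hxy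
      rw [inv_le_iff_one_le_mul₀ (by positivity), ← Real.sqrt_sq_eq_abs, ← Real.sqrt_mul (by positivity)]
      exact Real.one_le_sqrt.2 (by linarith)
  refine ⟨g, h1, h2, fun k hk t => (h3 k hk t).trans (le_of_eq ?_), h4⟩
  rw [inv_inv, Real.sqrt_eq_rpow, ← Real.rpow_natCast, ← Real.rpow_mul (by positivity)]
  ring_nf

end Fooling
-- Action of the sparse-grid operator on univariate functions and monomials.
section Operators

lemma actOn_add {d : ℕ} (T : (ℝ → ℝ) →ₗ[ℝ] (ℝ → ℝ)) (j : Fin d) (f g : (Fin d → ℝ) → ℝ) :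
    actOn T j (f + g) = actOn T j f + actOn T j g := by
  funext x
  have : (fun t => (f + g) (Function.update x j t)) =
    (fun t => f (Function.update x j t)) + fun t => g (Function.update x j t) := rfl
  rw [actOn, this, map_add]
  rfl

lemma actOn_smul {d : ℕ} (T : (ℝ → ℝ) →ₗ[ℝ] (ℝ → ℝ)) (j : Fin d) (c : ℝ)
    (f : (Fin d → ℝ) → ℝ) : actOn T j (c • f) = c • actOn T j f := by
  funext x
  have : (fun t => (c • f) (Function.update x j t)) =
    c • fun t => f (Function.update x j t) := rfl
  rw [actOn, this, map_smul]
  rfl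

lemma tensorOp_add {d : ℕ} (T : Fin d → (ℝ → ℝ) →ₗ[ℝ] (ℝ → ℝ)) (f g : (Fin d → ℝ) → ℝ) :
    tensorOp T (f + g) = tensorOp T f + tensorOp T g := by
  unfold tensorOp
  induction List.finRange d with
  | nil => rfl
  | cons a l ih => simp only [List.foldr_cons, ih, actOn_add]

lemma tensorOp_smul {d : ℕ} (T : Fin d → (ℝ → ℝ) →ₗ[ℝ] (ℝ → ℝ)) (c : ℝ)
    (f : (Fin d → ℝ) → ℝ) : tensorOp T (c • f) = c • tensorOp T f := by
  unfold tensorOp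
  induction List.finRange d with
  | nil => rfl
  | cons a l ih => simp only [List.foldr_cons, ih, actOn_smul]

/-- `sparseInterp` as a linear map. -/
noncomputable def sparseInterpLin {d : ℕ} (n : ℕ → ℕ) (Λ : Finset (Fin d → ℕ)) :
    ((Fin d → ℝ) → ℝ) →ₗ[ℝ] ((Fin d → ℝ) → ℝ) where
  toFun := sparseInterp n Λ
  map_add' f g := by simp only [sparseInterp, tensorOp_add, Finset.sum_add_distrib]
  map_smul' c f := by simp only [sparseInterp, tensorOp_smul, Finset.smul_sum, RingHom.id_apply]

lemma sparseInterp_congr {d : ℕ} {n : ℕ → ℕ} {Λ : Finset (Fin d → ℕ)} {f g : (Fin d → ℝ) → ℝ}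
    (h : ∀ x ∈ sparseGrid n Λ, f x = g x) : sparseInterp n Λ f = sparseInterp n Λ g := by
  refine Finset.sum_congr rfl fun ℓ hℓ => tensorOp_congr _
    (fun j => uniNodes n (ℓ j) ∪ uniNodes n (ℓ j - 1)) (fun j u v huv => ?_)
    fun x hx => h x (Finset.mem_biUnion.2 ⟨ℓ, hℓ, hx⟩)
  rw [LinearMap.sub_apply, LinearMap.sub_apply,
    uniInterp_congr n _ fun t ht => huv t (Finset.mem_union_left _ ht),
    uniInterp_congr n _ fun t ht => huv t (Finset.mem_union_right _ ht)]

lemma uniInterp_zero (n : ℕ → ℕ) : uniInterp n 0 = 0 := if_pos rfl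

lemma uniInterp_pow {n : ℕ → ℕ} {ℓ b : ℕ} (hℓ : 1 ≤ ℓ) (hb : b ≤ n ℓ) :
    uniInterp n ℓ (fun t => t ^ b) = fun t => t ^ b := by
  funext t
  rw [uniInterp, if_neg (by omega)]
  have h := Lagrange.eq_interpolate_of_eval_eq (s := hermiteZeros (n ℓ + 1)) (v := id)
    (r := fun t : ℝ => t ^ b) (f := Polynomial.X ^ b) (Set.injOn_id _)
    (by rw [Polynomial.degree_X_pow, card_hermiteZeros]; exact_mod_cast Nat.lt_succ_of_le hb)
    (fun i _ => by simp)
  simp only [polyInterp, LinearMap.coe_mk, AddHom.coe_mk]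
  rw [← h]
  simp

lemma uniInterp_one {n : ℕ → ℕ} {ℓ : ℕ} (hℓ : 1 ≤ ℓ) : uniInterp n ℓ (fun _ => 1) = fun _ => 1 := by
  simpa using uniInterp_pow (n := n) (b := 0) hℓ (Nat.zero_le _)

lemma sum_uniInterp_sub (n : ℕ → ℕ) (K : ℕ) :
    ∑ k ∈ Finset.Icc 1 K, (uniInterp n k - uniInterp n (k - 1)) = uniInterp n K := by
  induction K with
  | zero => simp [uniInterp_zero]
  | succ K ih => rw [Finset.sum_Icc_succ_top (by omega), ih]; simp

/-- If $\ell_i\ge 2$ for some $i\ne j$, the factor in direction $i$ is a difference of two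
interpolants of the constant $1$, hence zero. Only the axis indices survive, and their sum
telescopes. For $K=0$ nothing survives. -/
lemma sparseInterp_comp_eval {d : ℕ} {n : ℕ → ℕ} {Λ : Finset (Fin d → ℕ)} {j : Fin d} {K : ℕ}
    (hΛ : ∀ ℓ ∈ Λ, ∀ i, 1 ≤ ℓ i)
    (hK : ∀ k, Function.update (fun _ => 1) j k ∈ Λ ↔ 1 ≤ k ∧ k ≤ K) (g : ℝ → ℝ) :
    sparseInterp n Λ (fun x => g (x j)) = fun x => uniInterp n K g (x j) := by
  have hprod : (fun x : Fin d → ℝ => g (x j)) =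
      fun x => ∏ i, (if i = j then g else fun _ => 1) (x i) := by
    funext x
    rw [← Finset.mul_prod_erase _ _ (Finset.mem_univ j), if_pos rfl, Finset.prod_eq_one, mul_one]
    intro i hi
    rw [if_neg (Finset.ne_of_mem_erase hi)]
  funext x
  rw [hprod, sparseInterp, Finset.sum_apply, ← sum_uniInterp_sub n K, LinearMap.sum_apply,
    Finset.sum_apply]
  symm
  refine Finset.sum_of_injOn (fun k => Function.update (fun _ => 1) j k)
    (fun a _ b _ hab => by simpa using congrFun hab j)
    (fun k hk => (hK k).2 (Finset.mem_Icc.1 hk)) (fun ℓ hℓ hne => ?_) fun k hk => ?_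
  · rw [tensorOp_prod]
    obtain ⟨i, hij, hi⟩ : ∃ i, i ≠ j ∧ ℓ i ≠ 1 := by
      by_contra! h
      have he : Function.update (fun _ => 1) j (ℓ j) = ℓ := by
        funext i
        by_cases hi : i = j
        · subst hi; simp
        · simp [hi, h i hi]
      exact hne ⟨ℓ j, Finset.mem_coe.2 (Finset.mem_Icc.2 ((hK _).1 (by rwa [he]))), he⟩
    have h1 := hΛ ℓ hℓ i
    refine Finset.prod_eq_zero (Finset.mem_univ i) ?_
    rw [if_neg hij, LinearMap.sub_apply, uniInterp_one h1, uniInterp_one (by omega), sub_self]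
    rfl
  · rw [tensorOp_prod]
    dsimp only
    rw [← Finset.mul_prod_erase _ _ (Finset.mem_univ j), if_pos rfl,
      Function.update_self, Finset.prod_eq_one, mul_one]
    intro i hi
    rw [if_neg (Finset.ne_of_mem_erase hi), Function.update_of_ne (Finset.ne_of_mem_erase hi),
      LinearMap.sub_apply, uniInterp_one le_rfl, uniInterp_zero]
    simp

/-- $K$ is the largest level on the axis; the supremum of the empty set gives $K=0$ when the index
set misses the axis. -/
lemma DownwardClosedInOneDirection.exists_update_mem_iff {d : ℕ} {Λ : Finset (Fin d → ℕ)}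
    (h : DownwardClosedInOneDirection Λ) (hΛ : ∀ ℓ ∈ Λ, ∀ i, 1 ≤ ℓ i) :
    ∃ (j : Fin d) (K : ℕ), ∀ k, Function.update (fun _ => 1) j k ∈ Λ ↔ 1 ≤ k ∧ k ≤ K := by
  obtain ⟨j, hj⟩ := h
  set s := Λ.filter fun ℓ => ∀ i, i ≠ j → ℓ i = 1 with hs
  refine ⟨j, s.sup fun ℓ => ℓ j, fun k => ⟨fun hk => ⟨by simpa using hΛ _ hk j, ?_⟩, ?_⟩⟩
  · have := Finset.le_sup (f := fun ℓ : Fin d → ℕ => ℓ j)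
      (show Function.update (fun _ => 1) j k ∈ s from
        Finset.mem_filter.2 ⟨hk, fun i hi => by simp [hi]⟩)
    simpa using this
  · rintro ⟨h1, h2⟩
    have hne : s.Nonempty := by
      by_contra h0
      rw [Finset.not_nonempty_iff_eq_empty.1 h0] at h2
      simp at h2
      omega
    obtain ⟨ℓ, hℓ, he⟩ := Finset.exists_mem_eq_sup s hne fun ℓ => ℓ j
    rw [he] at h2
    obtain ⟨hℓΛ, hℓ1⟩ := Finset.mem_filter.1 hℓ
    refine hj (ℓ j) k h1 h2 ?_
    have : Function.update (fun _ => 1) j (ℓ j) = ℓ := by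
      funext i
      by_cases hi : i = j
      · subst hi; simp
      · simp [hi, hℓ1 i hi]
    rwa [this]

lemma mem_isotropicSet {d L : ℕ} {ℓ : Fin d → ℕ} :
    ℓ ∈ isotropicSet d L ↔ (∀ j, 1 ≤ ℓ j) ∧ ∑ j, ℓ j ≤ L := by
  simp only [isotropicSet, Finset.mem_filter, Fintype.mem_piFinset, Finset.mem_Icc]
  refine ⟨fun h => ⟨fun j => (h.1 j).1, h.2⟩, fun h => ⟨fun j => ⟨h.1 j, ?_⟩, h.2⟩⟩
  exact (Finset.single_le_sum (f := ℓ) (fun _ _ => Nat.zero_le _) (Finset.mem_univ j)).trans h.2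

lemma update_mem_isotropicSet_iff {d L : ℕ} (hL : d ≤ L) (j : Fin d) (k : ℕ) :
    Function.update (fun _ => 1) j k ∈ isotropicSet d L ↔ 1 ≤ k ∧ k ≤ L - d + 1 := by
  have hsum : ∑ i, Function.update (fun _ => 1) j k i = k + (d - 1) := by
    rw [← Finset.add_sum_erase _ _ (Finset.mem_univ j), Function.update_self,
      Finset.sum_congr rfl fun i hi =>
        Function.update_of_ne (Finset.ne_of_mem_erase hi) k (fun _ => 1)]
    simp
  have hd : 1 ≤ d := Fin.pos j
  rw [mem_isotropicSet, hsum]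
  refine ⟨fun h => ⟨by simpa using h.1 j, by omega⟩, fun h => ⟨fun i => ?_, by omega⟩⟩
  by_cases hi : i = j
  · subst hi; simpa using h.1
  · simp [hi]

/-- If $\ell_j>k_j$ for some $j$, levels $\ell_j$ and $\ell_j-1$ both reproduce $t^{\beta_j}$ and
the term vanishes. What remains is the box $\prod_j[1,k_j]$, where the sum factors and telescopes.
Exactness is required at all levels from $k_j$ on because $n$ need not be monotone. -/
lemma sparseInterp_monomial_isotropicSet {d L : ℕ} {n : ℕ → ℕ} {β k : Fin d → ℕ}
    (hk : ∀ j, 1 ≤ k j) (hkL : ∑ j, k j ≤ L) (hβ : ∀ j, ∀ ℓ, k j ≤ ℓ → β j ≤ n ℓ) :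
    sparseInterp n (isotropicSet d L) (fun x => ∏ j, x j ^ β j) = fun x => ∏ j, x j ^ β j := by
  funext x
  rw [sparseInterp, Finset.sum_apply]
  have hsub : (Fintype.piFinset fun j => Finset.Icc 1 (k j)) ⊆ isotropicSet d L := fun ℓ hℓ => by
    have h := fun j => Finset.mem_Icc.1 (Fintype.mem_piFinset.1 hℓ j)
    exact mem_isotropicSet.2
      ⟨fun j => (h j).1, (Finset.sum_le_sum fun j _ => (h j).2).trans hkL⟩
  have hterm : ∀ ℓ : Fin d → ℕ, tensorOp (fun j => uniInterp n (ℓ j) - uniInterp n (ℓ j - 1))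
      (fun x => ∏ j, x j ^ β j) x =
      ∏ j, (uniInterp n (ℓ j) - uniInterp n (ℓ j - 1)) (fun t => t ^ β j) (x j) := fun ℓ =>
    congrFun (tensorOp_prod (fun j => uniInterp n (ℓ j) - uniInterp n (ℓ j - 1))
      fun j t => t ^ β j) x
  simp only [hterm]
  rw [← Finset.sum_subset hsub]
  · rw [← Finset.prod_univ_sum (fun j => Finset.Icc 1 (k j)) fun j l =>
      (uniInterp n l - uniInterp n (l - 1)) (fun t => t ^ β j) (x j)]
    refine Finset.prod_congr rfl fun j _ => ?_
    rw [← Finset.sum_apply, ← LinearMap.sum_apply, sum_uniInterp_sub,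
      uniInterp_pow (hk j) (hβ j _ le_rfl)]
  · intro ℓ hℓ hn
    have h1 := (mem_isotropicSet.1 hℓ).1
    obtain ⟨j, hj⟩ : ∃ j, k j < ℓ j := by
      by_contra! h
      exact hn (Fintype.mem_piFinset.2 fun j => Finset.mem_Icc.2 ⟨h1 j, h j⟩)
    refine Finset.prod_eq_zero (Finset.mem_univ j) ?_
    have h2 := hk j
    rw [LinearMap.sub_apply, uniInterp_pow (h1 j) (hβ j _ hj.le),
      uniInterp_pow (by omega) (hβ j _ (by omega)), sub_self]
    rfl

lemma exists_cutoff {d : ℕ} (F : Finset (Fin d → ℝ)) :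
    ∃ χ : (Fin d → ℝ) → ℝ, ContDiff ℝ ∞ χ ∧ HasCompactSupport χ ∧ ∀ x ∈ F, χ x = 1 := by
  obtain ⟨R, hR⟩ := F.finite_toSet.isBounded.subset_closedBall (0 : Fin d → ℝ)
  let b : ContDiffBump (0 : Fin d → ℝ) :=
    ⟨max R 1, max R 1 + 1, by positivity, by linarith⟩
  exact ⟨b, b.contDiff, b.hasCompactSupport, fun x hx => b.one_of_mem_closedBall
    (Metric.closedBall_subset_closedBall (le_max_left _ _) (hR hx))⟩

lemma eq_zero_of_sum_monomials {d : ℕ} {S : Finset (Fin d → ℕ)} (c : S → ℝ)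
    (h : ∀ x : Fin d → ℝ, ∑ β : S, c β * ∏ j, x j ^ (β : Fin d → ℕ) j = 0) (β : S) : c β = 0 := by
  classical
  have hp : ∑ β : S, MvPolynomial.monomial
      (Finsupp.equivFunOnFinite.symm (β : Fin d → ℕ)) (c β) = 0 := MvPolynomial.funext fun x => by
    rw [map_zero, map_sum, ← h x]
    refine Finset.sum_congr rfl fun β _ => ?_
    rw [MvPolynomial.eval_monomial, Finsupp.prod_fintype _ _ (by simp)]
    rfl
  have := congrArg (MvPolynomial.coeff (Finsupp.equivFunOnFinite.symm (β : Fin d → ℕ))) hp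
  rw [MvPolynomial.coeff_sum, MvPolynomial.coeff_zero, Finset.sum_eq_single β] at this
  · simpa using this
  · intro γ _ hγ
    rw [MvPolynomial.coeff_monomial, if_neg]
    exact fun h => hγ (Subtype.ext (Finsupp.equivFunOnFinite.symm.injective h))
  · simp

/-- The number of monomials that are reproduced is at most the number of point evaluations. -/
lemma card_le_of_usesPointEvaluations {d α N : ℕ} {n : ℕ → ℕ} {Λ : Finset (Fin d → ℕ)}
    (hN : UsesPointEvaluations α N (sparseInterp n Λ)) (S : Finset (Fin d → ℕ))
    (hS : ∀ β ∈ S, sparseInterp n Λ (fun x => ∏ j, x j ^ β j) = fun x => ∏ j, x j ^ β j) :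
    S.card ≤ N := by
  classical
  by_contra! hlt
  obtain ⟨y, Φ, hΦ⟩ := hN
  obtain ⟨V, hV⟩ : ∃ V : (S → ℝ) →ₗ[ℝ] (Fin d → ℝ) → ℝ, ∀ c,
      V c = ∑ β : S, c β • fun x => ∏ j, x j ^ (β : Fin d → ℕ) j :=
    ⟨Fintype.linearCombination ℝ fun β : S => fun x => ∏ j, x j ^ (β : Fin d → ℕ) j,
      fun c => Fintype.linearCombination_apply ..⟩
  have hVx : ∀ c x, V c x = ∑ β : S, c β * ∏ j, x j ^ (β : Fin d → ℕ) j := fun c x => by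
    rw [hV, Finset.sum_apply]
    rfl
  -- With more monomials than points, some nontrivial combination $p$ vanishes at all of the points.
  obtain ⟨c, hc, hc0⟩ := (Submodule.ne_bot_iff _).1
    (LinearMap.ker_ne_bot_of_finrank_lt (f := LinearMap.funLeft ℝ ℝ y ∘ₗ V) (by simpa using hlt))
  have hcy : ∀ i, V c (y i) = 0 := fun i => congrFun (LinearMap.mem_ker.1 hc) i
  have hVs : ContDiff ℝ ∞ (V c) := by
    rw [show V c = fun x => ∑ β : S, c β * ∏ j, x j ^ (β : Fin d → ℕ) j from funext (hVx c)]
    exact ContDiff.sum fun β _ => contDiff_const.mul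
      (contDiff_prod fun j _ => (contDiff_apply ℝ ℝ j).pow _)
  obtain ⟨χ, hχ, hχc, hχ1⟩ := exists_cutoff (sparseGrid n Λ)
  have hrep : sparseInterp n Λ (V c) = V c := by
    change sparseInterpLin n Λ (V c) = V c
    rw [hV, map_sum]
    refine Finset.sum_congr rfl fun β _ => ?_
    rw [map_smul]
    exact congrArg (c β • ·) (hS β β.2)
  -- The cutoff $\chi$ puts $p\chi$ into the Sobolev space, and since $\chi=1$ on the grid the
  -- operator still returns $p$. But $p\chi$ has the same data as the zero function, so $p=0$.
  have h1 : sparseInterp n Λ (fun x => V c x * χ x) = V c :=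
    (sparseInterp_congr fun x hx => by rw [hχ1 x hx, mul_one]).trans hrep
  have h2 := hΦ _ (mem_sobolevSpace_of_hasCompactSupport α (hVs.mul hχ) hχc.mul_left)
  have h3 := hΦ (fun _ => 0) (mem_sobolevSpace_of_hasCompactSupport α contDiff_const
    HasCompactSupport.zero)
  have h4 : sparseInterp n Λ (fun _ : Fin d → ℝ => (0 : ℝ)) = 0 :=
    (sparseInterpLin n Λ).map_zero
  have h5 : (fun i => V c (y i) * χ (y i)) = fun _ => 0 := funext fun i => by
    rw [hcy, zero_mul]
  have h6 : V c = 0 := by rw [← h1, h2, h5, ← h3, h4]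
  exact hc0 (funext (eq_zero_of_sum_monomials c fun x => by rw [← hVx, h6]; rfl))

end Operators
-- Counting the reproduced monomials.
section Counting

lemma half_le_floor {x : ℝ} (hx : 1 ≤ x) : x / 2 ≤ (⌊x⌋₊ : ℝ) := by
  have h1 := Nat.lt_floor_add_one x
  have h2 : (1 : ℝ) ≤ ⌊x⌋₊ := by exact_mod_cast Nat.le_floor (by simpa using hx)
  linarith

/-- A lower bound for the cardinality of a hyperbolic cross. -/
lemma exists_hyperbolicCross (e : ℕ) {Q : ℝ} (hQ : 1 ≤ Q) :
    ∃ S : Finset (Fin (e + 1) → ℕ),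
      (∀ β ∈ S, (∀ j, 1 ≤ β j) ∧ ∏ j, (β j : ℝ) ≤ Q) ∧
      Q / 2 * (Real.log Q / (e + 1 : ℕ)) ^ e ≤ S.card := by
  have hQ0 : 0 < Q := by linarith
  -- With $e$ coordinates at most $Q^{1/(e+1)}$, their product is at most $Q$, so the remaining
  -- coordinate has at least $Q/(2\prod_j\beta_j)$ choices. Summing over the box gives a power of a
  -- harmonic sum, which supplies the logarithms.
  set P := ⌊Q ^ (1 / ((e + 1 : ℕ) : ℝ))⌋₊ with hP
  set T : Finset (Fin e → ℕ) := Fintype.piFinset fun _ => Finset.Icc 1 P with hT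
  have hT1 : ∀ β ∈ T, ∀ j, 1 ≤ β j ∧ β j ≤ P := fun β hβ j =>
    Finset.mem_Icc.1 (Fintype.mem_piFinset.1 hβ j)
  have hTpos : ∀ β ∈ T, 0 < ∏ j, (β j : ℝ) := fun β hβ =>
    Finset.prod_pos fun j _ => by exact_mod_cast (hT1 β hβ j).1
  have hTle : ∀ β ∈ T, ∏ j, (β j : ℝ) ≤ Q := fun β hβ => by
    have h0 : (0 : ℝ) ≤ Q ^ (1 / ((e + 1 : ℕ) : ℝ)) := by positivity
    have h1 : ∏ j, (β j : ℝ) ≤ ∏ _j : Fin e, Q ^ (1 / ((e + 1 : ℕ) : ℝ)) :=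
      Finset.prod_le_prod (fun _ _ => Nat.cast_nonneg _) fun j _ =>
        (Nat.cast_le.2 (hT1 β hβ j).2).trans (Nat.floor_le h0)
    refine h1.trans ?_
    rw [Finset.prod_const, Finset.card_univ, Fintype.card_fin]
    have h2 : (1 : ℝ) ≤ Q ^ (1 / ((e + 1 : ℕ) : ℝ)) := Real.one_le_rpow hQ (by positivity)
    refine (pow_le_pow_right₀ h2 (Nat.le_succ e)).trans (le_of_eq ?_)
    rw [← Real.rpow_natCast, ← Real.rpow_mul hQ0.le, one_div_mul_cancel (by positivity),
      Real.rpow_one]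
  let emb : (Σ _ : Fin e → ℕ, ℕ) ↪ (Fin (e + 1) → ℕ) :=
    ⟨fun p => Fin.cons p.2 p.1, fun p q h => by
      obtain ⟨h1, h2⟩ := Fin.cons_injective2 h
      exact Sigma.ext h2 (heq_of_eq h1)⟩
  refine ⟨(T.sigma fun β => Finset.Icc 1 ⌊Q / ∏ j, (β j : ℝ)⌋₊).map emb, fun β hβ => ?_, ?_⟩
  · obtain ⟨⟨γ, b⟩, hp, rfl⟩ := Finset.mem_map.1 hβ
    obtain ⟨hγ, hb⟩ := Finset.mem_sigma.1 hp
    dsimp only at hγ hb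
    rw [Finset.mem_Icc] at hb
    change (∀ j, 1 ≤ (Fin.cons b γ : Fin (e + 1) → ℕ) j) ∧
      ∏ j, (((Fin.cons b γ : Fin (e + 1) → ℕ) j : ℕ) : ℝ) ≤ Q
    refine ⟨fun j => ?_, ?_⟩
    · refine Fin.cases ?_ (fun i => ?_) j
      · simpa using hb.1
      · simpa using (hT1 γ hγ i).1
    · rw [Fin.prod_univ_succ]
      simp only [Fin.cons_zero, Fin.cons_succ]
      rw [← le_div_iff₀ (hTpos γ hγ)]
      exact (Nat.cast_le.2 hb.2).trans (Nat.floor_le (div_nonneg hQ0.le (hTpos γ hγ).le))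
  · rw [Finset.card_map, Finset.card_sigma]
    simp only [Nat.card_Icc, Nat.add_sub_cancel, Nat.cast_sum]
    have hlog : Real.log Q / (e + 1 : ℕ) ≤ ∑ b ∈ Finset.Icc 1 P, ((b : ℝ))⁻¹ := by
      have h1 : Real.log ((P : ℝ) + 1) ≤ ∑ b ∈ Finset.Icc 1 P, ((b : ℝ))⁻¹ := by
        have := log_add_one_le_harmonic P
        rw [harmonic_eq_sum_Icc] at this
        push_cast at this
        exact this
      refine le_trans ?_ h1
      have h2 := Real.log_le_log (by positivity) (Nat.lt_floor_add_one
        (Q ^ (1 / ((e + 1 : ℕ) : ℝ)))).le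
      rw [Real.log_rpow hQ0] at h2
      rw [div_eq_mul_one_div, mul_comm]
      exact h2
    calc Q / 2 * (Real.log Q / (e + 1 : ℕ)) ^ e
        ≤ Q / 2 * (∑ b ∈ Finset.Icc 1 P, ((b : ℝ))⁻¹) ^ e := by
          have := Real.log_nonneg hQ
          gcongr
      _ = ∑ β ∈ T, Q / (∏ j, (β j : ℝ)) / 2 := by
          have := Finset.prod_univ_sum (fun _ : Fin e => Finset.Icc 1 P)
            fun _ b => ((b : ℕ) : ℝ)⁻¹
          rw [Finset.prod_const, Finset.card_univ, Fintype.card_fin] at this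
          rw [this, Finset.mul_sum]
          refine Finset.sum_congr rfl fun β _ => ?_
          rw [Finset.prod_inv_distrib]
          ring
      _ ≤ _ := Finset.sum_le_sum fun β hβ =>
          half_le_floor ((one_le_div (hTpos β hβ)).2 (hTle β hβ))

/-- Every monomial whose exponents lie in the hyperbolic cross of size $M^{L-2d}$, $d=e+1$, is
reproduced. -/
lemma le_of_usesPointEvaluations_isotropicSet {e α N L : ℕ} {n : ℕ → ℕ} {M : ℝ} (hM : 1 < M)
    (hn : ∀ ℓ, 1 ≤ ℓ → M ^ (ℓ - 1) ≤ (n ℓ : ℝ)) (hL : 2 * (e + 1) ≤ L)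
    (hN : UsesPointEvaluations α N (sparseInterp n (isotropicSet (e + 1) L))) :
    M ^ (L - 2 * (e + 1)) / 2 *
      (((L - 2 * (e + 1) : ℕ) : ℝ) * Real.log M / (e + 1 : ℕ)) ^ e ≤ N := by
  obtain ⟨S, hS, hcard⟩ := exists_hyperbolicCross e (Q := M ^ (L - 2 * (e + 1)))
    (one_le_pow₀ hM.le)
  rw [Real.log_pow] at hcard
  refine hcard.trans (Nat.cast_le.2 (card_le_of_usesPointEvaluations hN S fun β hβ => ?_))
  obtain ⟨h1, h2⟩ := hS β hβ
  have hlM : 0 < Real.log M := Real.log_pos hM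
  have hβ1 : ∀ j, (1 : ℝ) ≤ β j := fun j => by exact_mod_cast h1 j
  have hq : ∀ j, 0 ≤ Real.log (β j) / Real.log M := fun j =>
    div_nonneg (Real.log_nonneg (hβ1 j)) hlM.le
  -- The $+1$ matches the exponent in $n_\ell\ge M^{\ell-1}$. Together with the rounding it costs at
  -- most $2$ per coordinate, which accounts for the shift by $2(e+1)$ in the size of the cross.
  refine sparseInterp_monomial_isotropicSet (k := fun j => ⌈Real.log (β j) / Real.log M⌉₊ + 1)
    (fun j => by omega) ?_ fun j ℓ hℓ => ?_
  · have h3 : ∑ j, Real.log (β j) / Real.log M ≤ ((L - 2 * (e + 1) : ℕ) : ℝ) := by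
      rw [← Finset.sum_div, div_le_iff₀ hlM, ← Real.log_prod fun j _ => by linarith [hβ1 j],
        ← Real.log_pow]
      exact Real.log_le_log (Finset.prod_pos fun j _ => by linarith [hβ1 j]) h2
    have h4 : ((∑ j, (⌈Real.log (β j) / Real.log M⌉₊ + 1) : ℕ) : ℝ) ≤ L := by
      push_cast
      have : ∀ j ∈ Finset.univ, (⌈Real.log (β j) / Real.log M⌉₊ : ℝ) + 1 ≤
          Real.log (β j) / Real.log M + 2 := fun j _ => by
        linarith [Nat.ceil_lt_add_one (hq j)]
      refine (Finset.sum_le_sum this).trans ?_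
      rw [Finset.sum_add_distrib]
      rw [Nat.cast_sub hL] at h3
      simp only [Finset.sum_const, Finset.card_univ, Fintype.card_fin, nsmul_eq_mul]
      push_cast at *
      linarith
    exact_mod_cast h4
  · have h5 : (β j : ℝ) ≤ M ^ ⌈Real.log (β j) / Real.log M⌉₊ := by
      rw [← Real.log_le_log_iff (by linarith [hβ1 j]) (by positivity), Real.log_pow,
        ← div_le_iff₀ hlM]
      exact Nat.le_ceil _
    have h6 : (β j : ℝ) ≤ n ℓ := h5.trans
      ((pow_le_pow_right₀ hM.le (by omega)).trans (hn ℓ (by omega)))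
    exact_mod_cast h6

/-- Use $\ln x\le x^\varepsilon/\varepsilon$ with $\varepsilon=1/(2(e+1))$, so that $e\varepsilon\le
1/2$. -/
lemma log_pow_le (e : ℕ) {x : ℝ} (hx : 1 ≤ x) :
    Real.log x ^ e ≤ (2 * (e + 1 : ℝ)) ^ e * √x := by
  have hε : (0 : ℝ) < 1 / (2 * (e + 1)) := by positivity
  have h1 := Real.log_le_rpow_div (x := x) (by linarith) hε
  rw [div_div_eq_mul_div, div_one, mul_comm] at h1
  refine (pow_le_pow_left₀ (Real.log_nonneg hx) h1 e).trans ?_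
  rw [mul_pow]
  gcongr
  rw [Real.sqrt_eq_rpow, ← Real.rpow_natCast, ← Real.rpow_mul (by linarith)]
  refine Real.rpow_le_rpow_of_exponent_le hx ?_
  rw [div_mul_eq_mul_div, one_mul, div_le_div_iff₀ (by positivity) (by norm_num)]
  linarith

/-- There is no upper bound on $N$, so three cases arise. If $N\ge M^{2L}$, both $M^L$ and the
logarithmic factor are $O(\sqrt N)$. Otherwise $\ln N\le 2L\ln M$: for $L\ge 4(e+1)$ one has $L\le
2(L-2(e+1))$ and the counting bound applies; for smaller $L$ the left-hand side is bounded. -/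
lemma exists_mul_pow_log_le (e : ℕ) {M : ℝ} (hM : 1 < M) : ∃ K : ℝ, 0 < K ∧ ∀ L N : ℕ, 1 ≤ N →
    (2 * (e + 1) ≤ L → M ^ (L - 2 * (e + 1)) / 2 *
      (((L - 2 * (e + 1) : ℕ) : ℝ) * Real.log M / (e + 1 : ℕ)) ^ e ≤ N) →
    M ^ L * Real.log N ^ e ≤ K * N := by
  have hlM : 0 < Real.log M := Real.log_pos hM
  have hM0 : 0 < M := by linarith
  set K₁ : ℝ := (2 * (e + 1 : ℝ)) ^ e
  set K₂ : ℝ := 2 * M ^ (2 * (e + 1)) * (4 * (e + 1 : ℝ)) ^ e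
  set K₃ : ℝ := M ^ (4 * (e + 1)) * (8 * (e + 1 : ℝ) * Real.log M) ^ e
  have hK₁ : 0 < K₁ := by positivity
  have hK₂ : 0 < K₂ := by positivity
  have hK₃ : 0 < K₃ := by positivity
  refine ⟨K₁ + K₂ + K₃, by positivity, fun L N hN h => ?_⟩
  have hN' : (1 : ℝ) ≤ N := by exact_mod_cast hN
  have hlN := Real.log_nonneg hN'
  have hN0 : (0 : ℝ) < N := by linarith
  suffices hs : M ^ L * Real.log N ^ e ≤ K₁ * N ∨ M ^ L * Real.log N ^ e ≤ K₂ * N ∨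
      M ^ L * Real.log N ^ e ≤ K₃ * N by
    have h1 := mul_pos hK₁ hN0
    have h2 := mul_pos hK₂ hN0
    have h3 := mul_pos hK₃ hN0
    rw [add_mul, add_mul]
    rcases hs with hs | hs | hs <;> linarith
  by_cases hNM : (M ^ L) ^ 2 ≤ (N : ℝ)
  · left
    have h1 : M ^ L ≤ √(N : ℝ) := Real.le_sqrt_of_sq_le hNM
    calc M ^ L * Real.log N ^ e ≤ √(N : ℝ) * (K₁ * √(N : ℝ)) :=
          mul_le_mul h1 (log_pow_le e hN') (by positivity) (by positivity)
      _ = K₁ * (√(N : ℝ) * √(N : ℝ)) := by ring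
      _ = K₁ * N := by rw [Real.mul_self_sqrt hN0.le]
  right
  push Not at hNM
  have hlog : Real.log N ≤ 2 * L * Real.log M := by
    have := Real.log_le_log hN0 hNM.le
    rw [← pow_mul, Real.log_pow] at this
    push_cast at this
    linarith
  by_cases hL : 4 * (e + 1) ≤ L
  · left
    have hN2 := h (by omega)
    have hL' : (4 * (e + 1) : ℝ) ≤ L := by exact_mod_cast hL
    have h1 : Real.log N ≤ 4 * (e + 1 : ℝ) *
        (((L - 2 * (e + 1) : ℕ) : ℝ) * Real.log M / (e + 1 : ℕ)) := by
      refine hlog.trans ?_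
      rw [Nat.cast_sub (by omega)]
      push_cast
      have : 4 * (e + 1 : ℝ) * (((L : ℝ) - 2 * (e + 1)) * Real.log M / (e + 1)) =
          4 * (L - 2 * (e + 1)) * Real.log M := by field_simp
      rw [this]
      exact mul_le_mul_of_nonneg_right (by linarith) hlM.le
    calc M ^ L * Real.log N ^ e ≤ M ^ L * (4 * (e + 1 : ℝ) *
        (((L - 2 * (e + 1) : ℕ) : ℝ) * Real.log M / (e + 1 : ℕ))) ^ e := by gcongr
      _ = K₂ * (M ^ (L - 2 * (e + 1)) / 2 *
          (((L - 2 * (e + 1) : ℕ) : ℝ) * Real.log M / (e + 1 : ℕ)) ^ e) := by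
          have hp : M ^ L = M ^ (2 * (e + 1)) * M ^ (L - 2 * (e + 1)) := by
            rw [← pow_add]; congr 1; omega
          rw [hp, mul_pow]
          ring
      _ ≤ K₂ * N := by gcongr
  · right
    push Not at hL
    have hL' : (L : ℝ) ≤ 4 * (e + 1) := by exact_mod_cast hL.le
    have h1 : Real.log N ≤ 8 * (e + 1 : ℝ) * Real.log M :=
      hlog.trans (mul_le_mul_of_nonneg_right (by linarith) hlM.le)
    calc M ^ L * Real.log N ^ e ≤ K₃ := by
          refine mul_le_mul (pow_le_pow_right₀ hM.le hL.le) ?_ (by positivity) (by positivity)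
          gcongr
      _ ≤ K₃ * N := le_mul_of_one_le_right hK₃.le hN'

end Counting

/-! ### Error and number of evaluations in terms of one axis. -/

section LowerBounds

/-- The error in terms of the number `m` of nodes along one coordinate axis. -/
lemma exists_worstCaseError_sparseInterp_ge (d α : ℕ) : ∃ κ : ℝ, 0 < κ ∧
    ∀ (n : ℕ → ℕ) (Λ : Finset (Fin d → ℕ)) (j : Fin d) (K m : ℕ),
      (∀ ℓ ∈ Λ, ∀ i, 1 ≤ ℓ i) →
      (∀ k, Function.update (fun _ => 1) j k ∈ Λ ↔ 1 ≤ k ∧ k ≤ K) →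
      1 ≤ m → (1 ≤ K → m = n K + 1) →
      ENNReal.ofReal (κ * (m : ℝ) ^ (-(α : ℝ) / 2)) ≤ worstCaseError α (sparseInterp n Λ) := by
  obtain ⟨κ, hκ, h1⟩ := exists_worstCaseError_ge d α
  obtain ⟨C, hC, h2⟩ := exists_hermite_fooling α
  refine ⟨κ / C, by positivity, fun n Λ j K m hΛ hK hm hmK => ?_⟩
  obtain ⟨g, hg, hg0, hgB, hvol⟩ := h2 m hm
  have hm0 : (0 : ℝ) < m := by exact_mod_cast hm
  have hA : sparseInterp n Λ (fun x => g (x j)) = 0 := by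
    rw [sparseInterp_comp_eval hΛ hK]
    have : uniInterp n K g = 0 := by
      -- For $K=0$ every univariate $g$ is mapped to zero, so $m$ may be chosen freely.
      rcases Nat.eq_zero_or_pos K with rfl | hK0
      · rw [uniInterp_zero, LinearMap.zero_apply]
      · rw [uniInterp_congr n K (v := 0) fun t ht => ?_, map_zero]
        rw [uniNodes, if_neg (by omega), ← hmK hK0] at ht
        exact hg0 t ht
    rw [this]
    rfl
  have := h1 _ j g _ (by positivity) hg hgB hvol hA
  rwa [neg_div, Real.rpow_neg hm0.le, div_mul_eq_mul_div, ← div_eq_mul_inv, div_div, mul_comm _ C]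

/-- The $n_K+1$ monomials $x_j^b$, $b\le n_K$, are reproduced. -/
lemma le_of_usesPointEvaluations_of_axis {d α N K : ℕ} {n : ℕ → ℕ} {Λ : Finset (Fin d → ℕ)}
    {j : Fin d} (hΛ : ∀ ℓ ∈ Λ, ∀ i, 1 ≤ ℓ i)
    (hK : ∀ k, Function.update (fun _ => 1) j k ∈ Λ ↔ 1 ≤ k ∧ k ≤ K) (hK1 : 1 ≤ K)
    (hN : UsesPointEvaluations α N (sparseInterp n Λ)) : n K + 1 ≤ N := by
  have hmon : ∀ b, (fun x : Fin d → ℝ => ∏ i, x i ^ (Pi.single j b : Fin d → ℕ) i) =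
      fun x => x j ^ b := fun b => by
    funext x
    rw [Finset.prod_eq_single_of_mem j (Finset.mem_univ j), Pi.single_eq_same]
    intro i _ hi
    rw [Pi.single_eq_of_ne hi, pow_zero]
  have := card_le_of_usesPointEvaluations hN
    ((Finset.range (n K + 1)).image fun b => Pi.single j b) fun β hβ => by
      obtain ⟨b, hb, rfl⟩ := Finset.mem_image.1 hβ
      rw [hmon, sparseInterp_comp_eval hΛ hK (fun t => t ^ b),
        uniInterp_pow hK1 (Nat.lt_succ_iff.1 (Finset.mem_range.1 hb))]
  rwa [Finset.card_image_of_injective _ (Pi.single_injective j), Finset.card_range] at this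

end LowerBounds
end SparseGH

theorem mainTheorem7 (d α : ℕ) (hd : 1 ≤ d) (hα : 1 ≤ α) :
    (∃ c : ℝ, 0 < c ∧
      ∀ (n : ℕ → ℕ) (Λ : Finset (Fin d → ℕ)), (∀ ℓ ∈ Λ, ∀ j, 1 ≤ ℓ j) →
        SparseGH.DownwardClosedInOneDirection Λ →
        ∀ N : ℕ, 1 ≤ N → SparseGH.UsesPointEvaluations α N (SparseGH.sparseInterp n Λ) →
          ENNReal.ofReal (c * (N : ℝ) ^ (-(α : ℝ) / 2)) ≤
            SparseGH.worstCaseError α (SparseGH.sparseInterp n Λ)) ∧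
    (∀ M₀ M : ℝ, 0 < M₀ → 1 < M → ∃ c : ℝ, 0 < c ∧
      ∀ (n : ℕ → ℕ) (L : ℕ), d ≤ L →
        (∀ ℓ : ℕ, 1 ≤ ℓ → M ^ (ℓ - 1) ≤ (n ℓ : ℝ) ∧ (n ℓ : ℝ) ≤ M₀ * (M ^ ℓ - 1)) →
        Real.exp ((d : ℝ) - 1) ≤ (n (L - d + 1) : ℝ) →
        ∀ N : ℕ, 1 ≤ N →
          SparseGH.UsesPointEvaluations α N
            (SparseGH.sparseInterp n (SparseGH.isotropicSet d L)) →
          ENNReal.ofReal (c * (N : ℝ) ^ (-(α : ℝ) / 2) *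
              Real.log N ^ ((α : ℝ) * ((d : ℝ) - 1) / 2)) ≤
            SparseGH.worstCaseError α
              (SparseGH.sparseInterp n (SparseGH.isotropicSet d L))) := by
  obtain ⟨κ, hκ, herr⟩ := SparseGH.exists_worstCaseError_sparseInterp_ge d α
  refine ⟨⟨κ, hκ, fun n Λ hΛ hdc N hN hNu => ?_⟩, fun M₀ M hM₀ hM => ?_⟩
  · obtain ⟨j, K, hK⟩ := hdc.exists_update_mem_iff hΛ
    -- If the index set misses the axis, the number of nodes is unconstrained and $m=N$ gives the
    -- claim.
    rcases Nat.eq_zero_or_pos K with hK0 | hK0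
    · exact herr n Λ j K N hΛ hK hN fun h => absurd h (by omega)
    · refine le_trans (ENNReal.ofReal_le_ofReal ?_)
        (herr n Λ j K (n K + 1) hΛ hK (by omega) fun _ => rfl)
      have hle := SparseGH.le_of_usesPointEvaluations_of_axis hΛ hK hK0 hNu
      have hα0 : -(α : ℝ) / 2 ≤ 0 := by
        have : (0 : ℝ) ≤ α := Nat.cast_nonneg _
        linarith
      exact mul_le_mul_of_nonneg_left (Real.rpow_le_rpow_of_nonpos
        (by exact_mod_cast Nat.succ_pos _) (by exact_mod_cast hle) hα0) hκ.le
  · obtain ⟨e, rfl⟩ : ∃ e, d = e + 1 := ⟨d - 1, by omega⟩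
    obtain ⟨K, hK, hlog⟩ := SparseGH.exists_mul_pow_log_le e hM
    set R : ℝ := (M₀ + 1) * K with hR
    have hR0 : 0 < R := by positivity
    refine ⟨κ / R ^ ((α : ℝ) / 2), by positivity, fun n L hL hn _ N hN hNu => ?_⟩
    have hmem : ∀ ℓ ∈ SparseGH.isotropicSet (e + 1) L, ∀ i, 1 ≤ ℓ i := fun ℓ hℓ =>
      (SparseGH.mem_isotropicSet.1 hℓ).1
    refine le_trans (ENNReal.ofReal_le_ofReal ?_)
      (herr n _ 0 (L - (e + 1) + 1) (n (L - (e + 1) + 1) + 1) hmem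
        (SparseGH.update_mem_isotropicSet_iff hL 0) (by omega) fun _ => rfl)
    have h1 := hlog L N hN fun h2L => SparseGH.le_of_usesPointEvaluations_isotropicSet hM
      (fun ℓ hℓ => (hn ℓ hℓ).1) h2L hNu
    set m : ℝ := ((n (L - (e + 1) + 1) + 1 : ℕ) : ℝ) with hm
    have hm0 : 0 < m := by positivity
    have hN' : (1 : ℝ) ≤ N := by exact_mod_cast hN
    have hlN := Real.log_nonneg hN'
    have hmle : m ≤ (M₀ + 1) * M ^ L := by
      have h2 := (hn (L - (e + 1) + 1) (by omega)).2
      have h3 : M ^ (L - (e + 1) + 1) ≤ M ^ L := pow_le_pow_right₀ hM.le (by omega)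
      have h4 : 1 ≤ M ^ L := one_le_pow₀ hM.le
      have h5 := mul_le_mul_of_nonneg_left h3 hM₀.le
      rw [hm]
      push_cast
      linarith
    -- Raised to the power $\alpha/2$, this turns $m^{-\alpha/2}$ into the claimed rate.
    have hkey : m * Real.log N ^ e ≤ R * N :=
      calc m * Real.log N ^ e ≤ (M₀ + 1) * M ^ L * Real.log N ^ e := by gcongr
        _ = (M₀ + 1) * (M ^ L * Real.log N ^ e) := by ring
        _ ≤ (M₀ + 1) * (K * N) := by gcongr
        _ = R * N := by ring
    have hpow := Real.rpow_le_rpow (by positivity) hkey (by positivity : (0 : ℝ) ≤ (α : ℝ) / 2)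
    rw [Real.mul_rpow hm0.le (by positivity), Real.mul_rpow hR0.le (by linarith),
      ← Real.rpow_natCast, ← Real.rpow_mul hlN] at hpow
    have hexp : (α : ℝ) * (((e + 1 : ℕ) : ℝ) - 1) / 2 = e * ((α : ℝ) / 2) := by
      push_cast; ring
    rw [hexp, neg_div, Real.rpow_neg (by linarith), Real.rpow_neg hm0.le]
    have hp1 : 0 < R ^ ((α : ℝ) / 2) := by positivity
    have hp2 : 0 < (N : ℝ) ^ ((α : ℝ) / 2) := Real.rpow_pos_of_pos (by linarith) _
    have hp3 : 0 < m ^ ((α : ℝ) / 2) := by positivity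
    rw [div_mul_eq_mul_div, div_mul_eq_mul_div, mul_assoc, mul_div_assoc]
    refine mul_le_mul_of_nonneg_left ?_ hκ.le
    rw [div_le_iff₀ hp1, inv_mul_le_iff₀ hp2, mul_left_comm, ← div_eq_inv_mul, le_div_iff₀ hp3]
    linarith
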